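/- **Notation.** Let $\{a_1\prec a_2\prec\dots\prec a_l\}$ be an ordered alphabet of $l$ letters. For words $u,v$ write $u\succ v$ if, at the first position where they differ, $u$ has the greater letter (a word and a prefix of it are incomparable). A word $W$ is *$n$-divisible* if $W=v\,u_1u_2\cdots u_n$ for some words with $u_1\succ u_2\succ\dots\succ u_n$. The *height* of a set $\mathcal M$ of words over a set $Y$ of words is the least $h$ such that every $u\in\mathcal M$ has the form $u=y_1^{k_1}\cdots y_r^{k_r}$ with $r\le h$, $y_i\in Y$. The *height* of an algebra $A$ with given generators over a set $Y$ of words in these generators is the least $h$ such that every element of $A$ is a linear combination of elements $y_1^{k_1}\cdots y_r^{k_r}$ with $r\le h$, $y_i\in Y$. A polynomial identity $f=0$ over a commutative ring $K$ ($f$ a noncommutative polynomial over $K$) is *admissible* if one of the coefficients of $f$ equals $1$. For $n\ge 2$ put $$\Phi(n,l)=2^{96}\,l\cdot n^{12\log_3 n+36\log_3\log_3 n+91}.$$ **Theorem.** 1. For all $n\ge2$ and $l\ge 0$, the set of words over an $l$-letter alphabet that are not $n$-divisible has finite height over the set of words of length less than $n$, and this height is at most $\Phi(n,l)$. 2. The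 bound is subexponential in $n$ and linear in $l$: for fixed $l\ge1$ and $n\to\infty$, $\Phi(n,l)=n^{12(1+o(1))\log_3 n}$, and hence $\Phi(n,l)=o(c^n)$ for every $c>1$ and every fixed $l\ge 0$; for each fixed $n\ge2$ there is a constant $C(n)$ with $\Phi(n,l)<C(n)\,l$ for all $l\ge1$. 3. Let $A$ be an associative algebra over a commutative ring, generated by $l$ elements, that satisfies an admissible polynomial identity of degree $n\ge2$. Then $A$ has finite height over the set of words of length less than $n$ in the generators, and this height is at most $\Phi(n,l)$. This holds both for algebras not assumed to have a unit, and for unital algebras that are generated by $l$ elements as unital algebras (where the empty word is allowed and $f$ may have a constant term). 4. (Answer to Zelmanov's question, which is the case $l=2$.) Let $F_{l,m}$ be the free $l$-generated associative ring without unit with the identity $x^m=0$, $m\ge1$. Then $F_{l,m}$ is nilpotent, and for each fixed $l$ its nilpotency class, i.e. the least $N$ with $F_{l,m}^N=0$, grows subexponentially in $m$: it is $o(c^m)$ as $m\to\infty$ for every $c>1$. -/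

import Mathlib

noncomputable section

namespace Shirshov

/-- The lexicographic order on words: `LexGT u v` says `u ≻ v`, i.e. at the first place where
they differ `u` has the greater letter. Words one of which is a prefix of the other are
incomparable. -/
def LexGT {α : Type*} [LinearOrder α] (u v : FreeMonoid α) : Prop :=
  ∃ (p s t : FreeMonoid α) (a b : α), b < a ∧
    u = p * FreeMonoid.of a * s ∧ v = p * FreeMonoid.of b * t

/-- `W` is `n`-divisible: `W = v u₁ ⋯ uₙ` with `u₁ ≻ ⋯ ≻ uₙ`. -/
def NDivisible {α : Type*} [LinearOrder α] (n : ℕ) (W : FreeMonoid α) : Prop :=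
  ∃ (v : FreeMonoid α) (us : List (FreeMonoid α)),
    us.length = n ∧ us.Pairwise LexGT ∧ W = v * us.prod

/-- The elements `u₁ ^ k₁ ⋯ u_r ^ k_r` with `r ≤ h` and all `u_i` in `Y`. -/
def powProducts {M : Type*} [Monoid M] (Y : Set M) (h : ℕ) : Set M :=
  {x | ∃ L : List (M × ℕ), L.length ≤ h ∧ (∀ p ∈ L, p.1 ∈ Y) ∧
    x = (L.map fun p => p.1 ^ p.2).prod}

/-- The words of length less than `n`. -/
def shortWords (α : Type*) (n : ℕ) : Set (FreeMonoid α) :=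
  {w | w.length < n}

/-- `h` is the height of the set of words `S` over the set of words `Y`. -/
def IsSetHeight {α : Type*} (S Y : Set (FreeMonoid α)) (h : ℕ) : Prop :=
  IsLeast {k : ℕ | S ⊆ powProducts Y k} h

/-- `h` is the least number such that every element of the submodule `S` of the algebra `B` is a
linear combination of products of at most `h` powers of elements of `Y`. -/
def IsSpanHeight (K : Type*) {B : Type*} [CommRing K] [Ring B] [Algebra K B]
    (S : Submodule K B) (Y : Set B) (h : ℕ) : Prop :=
  IsLeast {k : ℕ | S ≤ Submodule.span K (powProducts Y k)} h

/-- `h` is the height of the unital algebra `A`, with generators `a`, over the words of length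
less than `n` in these generators. -/
def IsUnitalAlgHeight (K : Type*) {A : Type*} [CommRing K] [Ring A] [Algebra K A]
    {l : ℕ} (a : Fin l → A) (n h : ℕ) : Prop :=
  IsSpanHeight K (⊤ : Submodule K A) (FreeMonoid.lift a '' shortWords (Fin l) n) h

/-- `h` is the height of the algebra `A` (not assumed unital), with generators `a`, over the words
of length less than `n` in these generators. Words are evaluated in the algebra obtained by
adjoining a unit; as all nonempty words lie in `A`, the empty word contributes nothing to the
linear combinations that represent elements of `A`. -/
def IsAlgHeight (K : Type*) {A : Type*} [CommRing K] [NonUnitalRing A] [Module K A]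
    [IsScalarTower K A A] [SMulCommClass K A A] {l : ℕ} (a : Fin l → A) (n h : ℕ) : Prop :=
  IsSpanHeight K (LinearMap.range (Unitization.inrHom K K A))
    (FreeMonoid.lift (fun i => (a i : Unitization K A)) '' shortWords (Fin l) n) h

/-- Noncommutative polynomials over `K` in the variables `x₀, x₁, …`: the free associative
algebra. -/
abbrev NCPoly (K : Type*) [CommRing K] : Type _ := MonoidAlgebra K (FreeMonoid ℕ)

/-- The degree of a noncommutative polynomial. -/
def NCPoly.degree {K : Type*} [CommRing K] (f : NCPoly K) : ℕ :=
  f.coeff.support.sup FreeMonoid.length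

/-- The value `f(x₀, x₁, …)` in a unital algebra. -/
def NCPoly.eval {K B : Type*} [CommRing K] [Ring B] [Algebra K B] (x : ℕ → B) (f : NCPoly K) : B :=
  MonoidAlgebra.lift K B (FreeMonoid ℕ) (FreeMonoid.lift x) f

/-- A polynomial is admissible if one of its coefficients is `1`. -/
def NCPoly.Admissible {K : Type*} [CommRing K] (f : NCPoly K) : Prop :=
  ∃ w, f.coeff w = 1

/-- `f = 0` is an identity of the unital algebra `A`. -/
def IsUnitalIdentity {K : Type*} (A : Type*) [CommRing K] [Ring A] [Algebra K A]
    (f : NCPoly K) : Prop :=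
  ∀ x : ℕ → A, f.eval x = 0

/-- `f = 0` is an identity of the algebra `A` (not assumed unital). The value is computed in the
algebra obtained by adjoining a unit; that it vanishes includes that `f` has no constant term. -/
def IsIdentity {K : Type*} (A : Type*) [CommRing K] [NonUnitalRing A] [Module K A]
    [IsScalarTower K A A] [SMulCommClass K A A] (f : NCPoly K) : Prop :=
  ∀ x : ℕ → A, f.eval (fun i => (x i : Unitization K A)) = 0

/-- `Φ(n, l) = 2⁹⁶ l n ^ (12 log₃ n + 36 log₃ log₃ n + 91)`. -/
def Phi (n l : ℕ) : ℝ :=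
  2 ^ 96 * (l : ℝ) * (n : ℝ) ^
    (12 * Real.logb 3 n + 36 * Real.logb 3 (Real.logb 3 n) + 91)

/-- The free associative ring without unit on `l` generators. -/
abbrev FreeNURing (l : ℕ) : Type := MonoidAlgebra ℤ (FreeSemigroup (Fin l))

/-- The ideal congruence on the free ring generated by `x ^ m = 0` for all `x`. -/
def nilCon (l m : ℕ) : RingCon (FreeNURing l) :=
  ringConGen fun y z => z = 0 ∧ ∃ x : FreeNURing l,
    (y : Unitization ℤ (FreeNURing l)) = (x : Unitization ℤ (FreeNURing l)) ^ m

/-- The free `l`-generated associative ring with the identity `x ^ m = 0`. -/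
abbrev FreeNilRing (l m : ℕ) : Type := (nilCon l m).Quotient

/-- `N` is the nilpotency class of `R`: the least `N` with `R ^ N = 0`, i.e. such that all products
of `N` elements vanish. (For `N = 0` the product is the unit adjoined to `R`, which is not zero.) -/
def IsNilpotencyClass (R : Type*) [NonUnitalRing R] (N : ℕ) : Prop :=
  IsLeast {k : ℕ | ∀ x : Fin k → R,
    (List.ofFn fun i => (x i : Unitization ℤ R)).prod = 0} N

end Shirshov

end

/-! Cut a word `W` with no `n`-division at its aperiodic positions, those that do not start a factor
of length `2n - 1` with a period less than `n`. Over a run of the other positions one period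
persists, so the stretch is `y ^ j * y'` with `y`, `y'` short. Hence the height is at most three
times the number of aperiodic positions, and these must be counted.

Fix a power of two `K = 2 ^ s` with `3n ≤ K ≤ 6n`. Colour a position by its residue modulo `K` and
by the length of a longest strictly decreasing chain of factors of length `K`, at congruent
positions, ending there (`decRank`). Such chains consist of disjoint factors and give divisions, so
there are at most `K (n - 1)` colours; along one colour the factors of length `K`, hence also their
prefixes, weakly increase. This monotonicity lets one count pairs (colour, factor): doubling the
length of the factor multiplies their number by at most `(K (n - 1)) ^ 2 + 2K`
(`card_image_color_pair_le`). Starting from single letters, `s` doublings give a bound linear in `l`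
and of size `n ^ O(log n)`.

The factor of length `K` that starts `n - 1` places before an aperiodic position has pairwise
comparable tails at its first `n` offsets. From `n` disjoint occurrences of such a factor one reads
off an `n`-division, taking the greatest tail in the first occurrence, the next one in the second,
and so on. So each pair (colour, factor) accounts for fewer than `n` aperiodic positions.

For algebras, an alternating sum of substitutions linearizes the degree `d` part of the identity,
modulo terms of higher degree. It rewrites a `d`-divisible word through smaller words of the same
length, and descending induction on `d` removes the higher terms, so words that are not
`n`-divisible span (`le_span_not_nDivisible`). In the nil case a long word that is not `m`-divisible
contains an `m`-th power and vanishes; the same rewriting then kills all long words. -/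

namespace Shirshov

open Finset

/-! ### Factors of a word at given positions. -/

section Windows

variable {α : Type*}

/-- The factor of length `k` of `W` that starts at the position `x` (cut off at the end of `W`). -/
def win (W : List α) (k x : ℕ) : List α := (W.drop x).take k

theorem length_win {W : List α} {k x : ℕ} (h : x + k ≤ W.length) : (win W k x).length = k := by
  simp only [win, List.length_take, List.length_drop]; omega

theorem take_win {W : List α} {j k x : ℕ} (h : j ≤ k) : (win W k x).take j = win W j x := by
  simp [win, List.take_take, h]

theorem drop_win {W : List α} {j k x : ℕ} : (win W k x).drop j = win W (k - j) (x + j) := by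
  simp [win, List.drop_take]

theorem win_add (W : List α) (j k x : ℕ) : win W (j + k) x = win W j x ++ win W k (x + j) := by
  simp [win, List.take_add]

theorem win_append_drop (W : List α) (k x : ℕ) : win W k x ++ W.drop (x + k) = W.drop x := by
  rw [win, ← List.drop_drop, List.take_append_drop]

theorem getElem?_win {W : List α} {k x i : ℕ} (h : i < k) : (win W k x)[i]? = W[x + i]? := by
  simp [win, h]

end Windows

/-! ### The lexicographic order, and divisions obtained from disjoint factors. -/

section Words

variable {α : Type*} [LinearOrder α]

/-- `LexGT` for words given as lists. -/
def ListGT (u v : List α) : Prop :=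
  ∃ (p s t : List α) (a b : α), b < a ∧ u = p ++ a :: s ∧ v = p ++ b :: t

theorem lexGT_ofList_iff {u v : List α} :
    LexGT (FreeMonoid.ofList u) (FreeMonoid.ofList v) ↔ ListGT u v := by
  constructor
  · rintro ⟨p, s, t, a, b, hab, hu, hv⟩
    refine ⟨p.toList, s.toList, t.toList, a, b, hab, ?_, ?_⟩
    · have := congrArg FreeMonoid.toList hu
      simpa using this
    · have := congrArg FreeMonoid.toList hv
      simpa using this
  · rintro ⟨p, s, t, a, b, hab, hu, hv⟩
    refine ⟨.ofList p, .ofList s, .ofList t, a, b, hab, ?_, ?_⟩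
    · apply FreeMonoid.toList.injective; simpa using hu
    · apply FreeMonoid.toList.injective; simpa using hv

theorem ListGT.cons {u v : List α} (a : α) (h : ListGT u v) : ListGT (a :: u) (a :: v) := by
  obtain ⟨p, s, t, x, y, hxy, rfl, rfl⟩ := h
  exact ⟨a :: p, s, t, x, y, hxy, rfl, rfl⟩

theorem ListGT.append_left {u v : List α} (q : List α) (h : ListGT u v) :
    ListGT (q ++ u) (q ++ v) := by
  obtain ⟨p, s, t, x, y, hxy, rfl, rfl⟩ := h
  exact ⟨q ++ p, s, t, x, y, hxy, by simp, by simp⟩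

theorem ListGT.append_right {u v : List α} (h : ListGT u v) (s t : List α) :
    ListGT (u ++ s) (v ++ t) := by
  obtain ⟨p, s', t', x, y, hxy, rfl, rfl⟩ := h
  exact ⟨p, s' ++ s, t' ++ t, x, y, hxy, by simp, by simp⟩

theorem ListGT.lt {u v : List α} (h : ListGT u v) : v < u := by
  obtain ⟨p, s, t, x, y, hxy, rfl, rfl⟩ := h
  induction p with
  | nil => exact List.cons_lt_cons_iff.2 (Or.inl hxy)
  | cons c p ih => exact List.cons_lt_cons_iff.2 (Or.inr ⟨rfl, ih⟩)

theorem listGT_cons_cons {u v : List α} {a b : α} :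
    ListGT (a :: u) (b :: v) ↔ b < a ∨ a = b ∧ ListGT u v := by
  constructor
  · rintro ⟨p, s, t, x, y, hxy, hu, hv⟩
    cases p with
    | nil =>
      simp only [List.nil_append, List.cons.injEq] at hu hv
      left; rw [hu.1, hv.1]; exact hxy
    | cons c p =>
      simp only [List.cons_append, List.cons.injEq] at hu hv
      exact Or.inr ⟨hu.1.trans hv.1.symm, p, s, t, x, y, hxy, hu.2, hv.2⟩
  · rintro (h | ⟨rfl, h⟩)
    · exact ⟨[], u, v, a, b, h, rfl, rfl⟩
    · exact h.cons a

theorem not_listGT_nil_left (v : List α) : ¬ ListGT [] v := by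
  rintro ⟨p, s, t, x, y, -, h, -⟩; simp at h

theorem not_listGT_nil_right (v : List α) : ¬ ListGT v [] := by
  rintro ⟨p, s, t, x, y, -, -, h⟩; simp at h

theorem listGT_trans {u v w : List α} (h : ListGT u v) (h' : ListGT v w) : ListGT u w := by
  induction u generalizing v w with
  | nil => exact (not_listGT_nil_left _ h).elim
  | cons a u ih =>
    cases v with
    | nil => exact (not_listGT_nil_left _ h').elim
    | cons b v =>
      cases w with
      | nil => exact (not_listGT_nil_right _ h').elim
      | cons c w =>
        rw [listGT_cons_cons] at *
        rcases h with h | ⟨rfl, h⟩ <;> rcases h' with h' | ⟨rfl, h'⟩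
        · exact Or.inl (h'.trans h)
        · exact Or.inl h
        · exact Or.inl h'
        · exact Or.inr ⟨rfl, ih h h'⟩

/-- Two words are lexicographically comparable unless one is a prefix of the other. -/
theorem listGT_trichotomy (u v : List α) :
    ListGT u v ∨ ListGT v u ∨ u <+: v ∨ v <+: u := by
  induction u generalizing v with
  | nil => exact Or.inr (Or.inr (Or.inl List.nil_prefix))
  | cons a u ih =>
    cases v with
    | nil => exact Or.inr (Or.inr (Or.inr List.nil_prefix))
    | cons b v =>
      rcases lt_trichotomy a b with h | rfl | h
      · exact Or.inr (Or.inl (listGT_cons_cons.2 (Or.inl h)))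
      · simp only [listGT_cons_cons, lt_irrefl, false_or, true_and, List.cons_prefix_cons]
        exact ih v
      · exact Or.inl (listGT_cons_cons.2 (Or.inl h))

theorem listGT_of_lt {u v : List α} (h : v < u) (hl : u.length = v.length) : ListGT u v := by
  rcases listGT_trichotomy u v with h1 | h1 | h1 | h1
  · exact h1
  · exact (lt_asymm h h1.lt).elim
  · exact (h.ne (h1.eq_of_length hl).symm).elim
  · exact (h.ne (h1.eq_of_length hl.symm)).elim

theorem take_le_take {u v : List α} (h : u ≤ v) (hl : u.length = v.length) (k : ℕ) :
    u.take k ≤ v.take k := by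
  by_contra hlt
  have hgt := listGT_of_lt (not_le.1 hlt) (by simp [hl])
  have := (hgt.append_right (u.drop k) (v.drop k)).lt
  rw [List.take_append_drop, List.take_append_drop] at this
  exact absurd h (not_le.2 this)

/-- `NDivisible` for words given as lists. -/
def ListNDivisible (n : ℕ) (W : List α) : Prop :=
  ∃ (v : List α) (us : List (List α)), us.length = n ∧ us.Pairwise ListGT ∧ W = v ++ us.flatten

theorem nDivisible_ofList_iff {n : ℕ} {W : List α} :
    NDivisible n (FreeMonoid.ofList W) ↔ ListNDivisible n W := by
  constructor
  · rintro ⟨v, us, h1, h2, h3⟩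
    refine ⟨v.toList, us.map FreeMonoid.toList, by simpa using h1, ?_, ?_⟩
    · rw [List.pairwise_map]
      exact h2.imp fun h => lexGT_ofList_iff.1 h
    · have := congrArg FreeMonoid.toList h3
      simpa [FreeMonoid.toList_prod] using this
  · rintro ⟨v, us, h1, h2, h3⟩
    refine ⟨.ofList v, us.map FreeMonoid.ofList, by simpa using h1, ?_, ?_⟩
    · rw [List.pairwise_map]
      exact h2.imp fun h => lexGT_ofList_iff.2 h
    · apply FreeMonoid.toList.injective
      simpa [FreeMonoid.toList_prod, Function.comp_def] using h3

/-- Disjoint factors, from left to right strictly decreasing, give a division. The pair `(x, k)`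
stands for the factor of length `k` at the position `x`. -/
theorem exists_division_of_chain {W : List α} (ps : List (ℕ × ℕ)) (p : ℕ × ℕ)
    (hc : (p :: ps).IsChain fun a b =>
      a.1 + a.2 ≤ b.1 ∧ ListGT (win W a.2 a.1) (win W b.2 b.1)) :
    ∃ (s : List α) (us : List (List α)), us.length = ps.length ∧
      ((win W p.2 p.1 ++ s) :: us).Pairwise ListGT ∧
      W.drop p.1 = ((win W p.2 p.1 ++ s) :: us).flatten := by
  induction ps generalizing p with
  | nil =>
    refine ⟨W.drop (p.1 + p.2), [], rfl, by simp, ?_⟩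
    simp [win_append_drop]
  | cons b ps ih =>
    rw [List.isChain_cons_cons] at hc
    obtain ⟨⟨h1, h2⟩, h3⟩ := hc
    obtain ⟨s, us, e1, e2, e3⟩ := ih b h3
    have hgt : ∀ r, ListGT (win W p.2 p.1 ++ r) (win W b.2 b.1 ++ s) := fun r =>
      h2.append_right r s
    -- The factor absorbs the gap up to the next one; extending words on the right does not disturb
    -- a strict comparison.
    refine ⟨win W (b.1 - (p.1 + p.2)) (p.1 + p.2), (win W b.2 b.1 ++ s) :: us, by simp [e1], ?_, ?_⟩
    · rw [List.pairwise_cons]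
      refine ⟨?_, e2⟩
      intro w hw
      rcases List.mem_cons.1 hw with rfl | hw
      · exact hgt _
      · exact listGT_trans (hgt _) ((List.pairwise_cons.1 e2).1 w hw)
    · rw [List.flatten_cons, ← e3, List.append_assoc]
      conv_rhs => rw [show b.1 = p.1 + p.2 + (b.1 - (p.1 + p.2)) by omega]
      rw [show p.1 + p.2 + (b.1 - (p.1 + p.2)) - (p.1 + p.2) = b.1 - (p.1 + p.2) by omega,
        win_append_drop, win_append_drop]

theorem listNDivisible_of_chain {W : List α} {n : ℕ} (hn : 0 < n) (ps : List (ℕ × ℕ))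
    (hl : ps.length = n)
    (hc : ps.IsChain fun a b => a.1 + a.2 ≤ b.1 ∧ ListGT (win W a.2 a.1) (win W b.2 b.1)) :
    ListNDivisible n W := by
  cases ps with
  | nil => simp at hl; omega
  | cons p ps =>
    obtain ⟨s, us, e1, e2, e3⟩ := exists_division_of_chain ps p hc
    refine ⟨W.take p.1, _ :: us, by simpa [e1] using hl, e2, ?_⟩
    rw [← e3, List.take_append_drop]

theorem listNDivisible_mono {W : List α} {m n : ℕ} (hmn : m ≤ n) (h : ListNDivisible n W) :
    ListNDivisible m W := by
  obtain ⟨v, us, h1, h2, h3⟩ := h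
  refine ⟨v ++ (us.take (n - m)).flatten, us.drop (n - m), by simp [h1]; omega,
    h2.sublist (List.drop_sublist _ _), ?_⟩
  rw [List.append_assoc, ← List.flatten_append, List.take_append_drop, h3]

end Words

/-! ### Counting pairs of values of a function that increases along colours. -/

section Counting

theorem card_image_le_card_image {ι β γ : Type*} [DecidableEq β] [DecidableEq γ] (G : Finset ι)
    (f : ι → β) (g : ι → γ) (h : ∀ x ∈ G, ∀ y ∈ G, f x = f y → g x = g y) :
    (G.image g).card ≤ (G.image f).card := by
  classical
  have hex : ∀ b ∈ G.image g, ∃ x ∈ G, g x = b := fun b hb => by simpa using hb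
  obtain rfl | hne := G.eq_empty_or_nonempty
  · simp
  have : Nonempty ι := ⟨hne.choose⟩
  choose! s hs using hex
  refine Finset.card_le_card_of_injOn (fun b => f (s b)) (fun b hb => ?_) ?_
  · exact Finset.mem_image_of_mem _ (hs b hb).1
  · intro b hb b' hb' hbb
    rw [← (hs b hb).2, ← (hs b' hb').2]
    exact h _ (hs b hb).1 _ (hs b' hb').1 hbb

variable {C β : Type*} [LinearOrder β]

/-- If `f` is weakly increasing along every colour, then `f x` is determined by the colour of `x`
and by the number of pairs (colour, value) that occur up to `x`; hence the pairs `(f x, f (x + k))`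
take few values along the colours. -/
theorem card_image_color_pair_le [Fintype C] [DecidableEq C] {γ : Type*} [DecidableEq γ]
    (M k : ℕ) (hM : 0 < M) (c : ℕ → C) (f : ℕ → β) (g : ℕ → γ)
    (hmono : ∀ x y, x < y → y < M → c x = c y → f x ≤ f y)
    (hg : ∀ x y, f x = f y → f (x + k) = f (y + k) → g x = g y) :
    ((range M).image fun x => (c x, g x)).card ≤
      (Fintype.card C ^ 2 + 2 * k) * ((range M).image fun x => (c x, f x)).card := by
  -- `F` below holds the first occurrences of the pairs (colour, value), and `R x` is the number of
  -- them up to `x`.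
  classical
  set E := (range M).image fun x => (c x, f x) with hE
  set F := (range M).filter fun x => ∀ y < x, (c y, f y) ≠ (c x, f x) with hF
  have hFE : F.card ≤ E.card := by
    refine Finset.card_le_card_of_injOn (fun x => (c x, f x)) (fun x hx => ?_) ?_
    · exact Finset.mem_image_of_mem _ (Finset.mem_filter.1 hx).1
    · intro x hx y hy hxy
      have hx := (Finset.mem_filter.1 hx).2
      have hy := (Finset.mem_filter.1 hy).2
      rcases lt_trichotomy x y with h | h | h
      · exact (hy x h hxy).elim
      · exact h
      · exact (hx y h hxy.symm).elim
  set R : ℕ → ℕ := fun x => (F.filter (· ≤ x)).card with hR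
  have hRmono : ∀ x y z, x < z → z ≤ y → z ∈ F → R x < R y := by
    intro x y z hxz hzy hz
    apply Finset.card_lt_card
    rw [Finset.ssubset_iff_of_subset]
    · exact ⟨z, by simp [hz, hzy], by simp [hxz]⟩
    · intro w hw
      simp only [Finset.mem_filter] at *
      exact ⟨hw.1, by omega⟩
  -- If `z` is the first occurrence of the pair of `y`, equal ranks force `z ≤ x`. Then `f x` is
  -- squeezed between `f z` and `f y`, which agree.
  have hdet' : ∀ x y, x ≤ y → y < M → c x = c y → R x = R y → f x = f y := by
    intro x y hxy hy hc hRxy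
    have hex : ∃ z, (c z, f z) = (c y, f y) := ⟨y, rfl⟩
    set z := Nat.find hex with hz
    have hz1 : (c z, f z) = (c y, f y) := Nat.find_spec hex
    have hzy : z ≤ y := Nat.find_min' hex rfl
    have hzF : z ∈ F := by
      simp only [hF, Finset.mem_filter, Finset.mem_range]
      refine ⟨by omega, fun w hw h => ?_⟩
      exact Nat.find_min hex hw (h.trans hz1)
    have hzx : z ≤ x := by
      by_contra h
      have := hRmono x y z (by omega) hzy hzF
      omega
    simp only [Prod.mk.injEq] at hz1
    have h1 : f z ≤ f x := by
      rcases hzx.eq_or_lt with h | h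
      · rw [h]
      · exact hmono z x h (by omega) (hz1.1.trans hc.symm)
    have h2 : f x ≤ f y := by
      rcases hxy.eq_or_lt with h | h
      · rw [h]
      · exact hmono x y h hy hc
    exact le_antisymm h2 (hz1.2 ▸ h1)
  have hdet : ∀ x y, x < M → y < M → c x = c y → R x = R y → f x = f y := by
    intro x y hx hy hc h
    rcases le_total x y with hxy | hxy
    · exact hdet' x y hxy hy hc h
    · exact (hdet' y x hxy hx hc.symm h.symm).symm
  -- On `G` no first occurrence lies in `(x, x + k]`, so one rank serves both `x` and `x + k`, and
  -- two colours with this rank determine `g x`. The other positions are few and are counted one by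
  -- one.
  set G := (range M).filter fun x => x + k < M ∧ R x = R (x + k) with hG
  set Bd := (range M).filter fun x => ¬ (x + k < M ∧ R x = R (x + k)) with hBd
  have hsplit : ((range M).image fun x => (c x, g x)) =
      (G.image fun x => (c x, g x)) ∪ (Bd.image fun x => (c x, g x)) := by
    rw [← Finset.image_union, hG, hBd, Finset.filter_union_filter_not_eq]
  have hGc : (G.image fun x => (c x, g x)).card ≤ Fintype.card C ^ 2 * F.card := by
    calc (G.image fun x => (c x, g x)).card
        ≤ (G.image fun x => ((c x, c (x + k)), R x)).card := by
          apply card_image_le_card_image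
          intro x hx y hy hxy
          simp only [hG, Finset.mem_filter, Finset.mem_range] at hx hy
          simp only [Prod.mk.injEq] at hxy ⊢
          refine ⟨hxy.1.1, hg x y (hdet x y hx.1 hy.1 hxy.1.1 hxy.2) ?_⟩
          exact hdet _ _ hx.2.1 hy.2.1 hxy.1.2 (by rw [← hx.2.2, ← hy.2.2, hxy.2])
      _ ≤ ((Finset.univ : Finset (C × C)) ×ˢ Finset.Icc 1 F.card).card := by
          apply Finset.card_le_card
          intro t ht
          obtain ⟨x, hx, rfl⟩ := Finset.mem_image.1 ht
          simp only [Finset.mem_product, Finset.mem_univ, true_and, Finset.mem_Icc]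
          refine ⟨Finset.card_pos.2 ⟨0, ?_⟩, Finset.card_le_card (Finset.filter_subset _ _)⟩
          simp [hF, hM]
      _ = Fintype.card C ^ 2 * F.card := by
          rw [Finset.card_product, Finset.card_univ, Fintype.card_prod, Nat.card_Icc]
          simp [sq]
  have hBc : Bd.card ≤ k * (F.card + 1) := by
    -- An exceptional `x` lies at most `k` places before a first occurrence, or before the end `M`,
    -- which acts as an extra one.
    calc Bd.card ≤ ((insert M F).biUnion fun z => Finset.Ico (z - k) z).card := by
          apply Finset.card_le_card
          intro x hx
          simp only [hBd, Finset.mem_filter, Finset.mem_range, not_and_or] at hx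
          simp only [Finset.mem_biUnion, Finset.mem_insert, Finset.mem_Ico]
          by_cases hxk : x + k < M
          · have hne : R x ≠ R (x + k) := by tauto
            by_contra hcon
            apply hne
            simp only [hR]
            congr 1
            ext z
            simp only [Finset.mem_filter]
            refine ⟨fun h => ⟨h.1, by omega⟩, fun h => ⟨h.1, ?_⟩⟩
            by_contra hz
            exact hcon ⟨z, Or.inr h.1, by omega, by omega⟩
          · exact ⟨M, Or.inl rfl, by omega, hx.1⟩
      _ ≤ ∑ z ∈ insert M F, (Finset.Ico (z - k) z).card := Finset.card_biUnion_le
      _ ≤ ∑ z ∈ insert M F, k := by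
          apply Finset.sum_le_sum
          intro z _
          rw [Nat.card_Ico]; omega
      _ = (insert M F).card * k := by simp
      _ ≤ k * (F.card + 1) := by
          rw [mul_comm]
          exact Nat.mul_le_mul_left _ (Finset.card_insert_le _ _)
  have hE1 : 1 ≤ E.card := Finset.card_pos.2 ⟨(c 0, f 0), Finset.mem_image_of_mem _ (by simpa)⟩
  calc _ ≤ (G.image fun x => (c x, g x)).card + (Bd.image fun x => (c x, g x)).card := by
        rw [hsplit]; exact Finset.card_union_le _ _
    _ ≤ Fintype.card C ^ 2 * F.card + k * (F.card + 1) :=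
        Nat.add_le_add hGc (Finset.card_image_le.trans hBc)
    _ ≤ Fintype.card C ^ 2 * E.card + k * (E.card + E.card) := by gcongr
    _ = _ := by ring

end Counting

end Shirshov

namespace Shirshov

open Finset

/-! ### Colouring positions by decreasing chains; words with comparable tails. -/

section Coloring

variable {α : Type*} [LinearOrder α]

/-- The number of steps in a longest chain of factors of length `K`, at positions congruent
modulo `K`, that strictly decreases from left to right and ends at the position `x`. -/
def decRank (W : List α) (K x : ℕ) : ℕ :=
  ((range x).filter fun y => y % K = x % K ∧ win W K x < win W K y).attach.sup fun y =>
    decRank W K y.1 + 1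
termination_by x
decreasing_by
  have := y.2
  simp only [Finset.mem_filter, Finset.mem_range] at this
  exact this.1

theorem decRank_lt {W : List α} {K x y : ℕ} (hxy : x < y) (hmod : x % K = y % K)
    (hlt : win W K y < win W K x) : decRank W K x < decRank W K y := by
  rw [decRank.eq_1 W K y]
  have hx : x ∈ (range y).filter fun z => z % K = y % K ∧ win W K y < win W K z := by
    simp [hxy, hmod, hlt]
  exact Finset.le_sup (f := fun z : {z // z ∈ (range y).filter fun z =>
    z % K = y % K ∧ win W K y < win W K z} => decRank W K z.1 + 1) (Finset.mem_attach _ ⟨x, hx⟩)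

/-- Follow the maximizers in the recursion backwards. Distinct congruent positions differ by at
least `K`, so the factors are disjoint, and their equal lengths turn `<` into a comparison at a
differing letter. -/
theorem exists_chain_decRank {W : List α} {K : ℕ} (x : ℕ) (hx : x + K ≤ W.length) :
    ∃ ps : List ℕ, ps.length = decRank W K x ∧
      (ps ++ [x]).IsChain fun a b => a + K ≤ b ∧ ListGT (win W K a) (win W K b) := by
  induction x using Nat.strong_induction_on with
  | _ x ih =>
    set s := (range x).filter fun y => y % K = x % K ∧ win W K x < win W K y with hs
    have hdef : decRank W K x = s.attach.sup fun y => decRank W K y.1 + 1 := decRank.eq_1 W K x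
    by_cases hne : s.attach.Nonempty
    · obtain ⟨⟨y, hy⟩, -, hy'⟩ := Finset.exists_mem_eq_sup s.attach hne
        (fun y => decRank W K y.1 + 1)
      simp only [hs, Finset.mem_filter, Finset.mem_range] at hy
      obtain ⟨hyx, hmod, hlt⟩ := hy
      have hK : y + K ≤ x := by
        have h := Nat.sub_mod_eq_zero_of_mod_eq hmod.symm
        have := Nat.le_of_dvd (by omega) (Nat.dvd_of_mod_eq_zero h)
        omega
      obtain ⟨ps, h1, h2⟩ := ih y hyx (by omega)
      refine ⟨ps ++ [y], by rw [hdef, hy']; simp [h1], ?_⟩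
      rw [List.isChain_append]
      refine ⟨h2, List.isChain_singleton _, ?_⟩
      intro a ha b hb
      simp only [List.getLast?_append, List.getLast?_singleton, Option.some_or, Option.mem_def,
        Option.some.injEq, List.head?_cons] at ha hb
      subst ha hb
      exact ⟨hK, listGT_of_lt hlt (by rw [length_win (by omega), length_win hx])⟩
    · refine ⟨[], ?_, by simp⟩
      rw [hdef, Finset.not_nonempty_iff_eq_empty.1 hne]
      simp

theorem decRank_lt_of_not_listNDivisible {W : List α} {n K x : ℕ} (hn : 2 ≤ n)
    (hW : ¬ ListNDivisible n W) (hx : x + K ≤ W.length) : decRank W K x < n - 1 := by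
  by_contra hlt
  obtain ⟨ps, h1, h2⟩ := exists_chain_decRank x hx
  apply hW
  apply listNDivisible_mono (n := decRank W K x + 1) (by omega)
  refine listNDivisible_of_chain (by omega) ((ps ++ [x]).map fun a => (a, K)) (by simp [h1]) ?_
  rw [List.isChain_map]
  exact h2

/-- The tails of `v` at the first `n` positions are pairwise comparable. -/
def TailsComparable (n : ℕ) (v : List α) : Prop :=
  ∀ i j, i < j → j < n → ListGT (v.drop i) (v.drop j) ∨ ListGT (v.drop j) (v.drop i)

theorem TailsComparable.exists_sorted {n : ℕ} {v : List α} (h : TailsComparable n v) :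
    ∃ os : List ℕ, os.length = n ∧ (∀ o ∈ os, o < n) ∧
      os.Pairwise fun i j => ListGT (v.drop i) (v.drop j) := by
  classical
  let r : ℕ → ℕ → Prop := fun i j => v.drop j ≤ v.drop i
  have ht : Std.Total r := ⟨fun i j => le_total _ _⟩
  have htr : IsTrans ℕ r := ⟨fun i j k hij hjk => le_trans hjk hij⟩
  have hperm := List.perm_insertionSort r (List.range n)
  have hlt : ∀ o ∈ List.insertionSort r (List.range n), o < n := fun o ho =>
    List.mem_range.1 (hperm.mem_iff.1 ho)
  refine ⟨List.insertionSort r (List.range n), by simp, hlt, ?_⟩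
  have hnd : (List.insertionSort r (List.range n)).Nodup := hperm.nodup_iff.2 List.nodup_range
  refine ((List.pairwise_insertionSort r (List.range n)).and hnd).imp_of_mem ?_
  intro i j hi hj hij
  obtain ⟨hij, hne⟩ := hij
  rcases lt_or_gt_of_ne hne with hl | hl
  · exact (h i j hl (hlt j hj)).resolve_right fun h' => absurd hij (not_le.2 h'.lt)
  · exact (h j i hl (hlt i hi)).resolve_left fun h' => absurd hij (not_le.2 h'.lt)

/-- A word with comparable tails has fewer than `n` disjoint occurrences. -/
theorem listNDivisible_of_occurrences {W v : List α} {n K : ℕ} (hn : 0 < n) (hnK : n ≤ K)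
    (hv : TailsComparable n v) (ys : List ℕ) (hl : ys.length = n)
    (hys : ys.Pairwise fun a b => a + K ≤ b) (hw : ∀ y ∈ ys, win W K y = v) :
    ListNDivisible n W := by
  obtain ⟨os, ho1, ho2, ho3⟩ := hv.exists_sorted
  -- With the offsets `os` sorted by decreasing tail, the `i`-th occurrence contributes its `i`-th
  -- greatest tail, which ends where the occurrence ends.
  refine listNDivisible_of_chain hn (List.zipWith (fun y o => (y + o, K - o)) ys os)
    (by simp [hl, ho1]) ?_
  apply List.Pairwise.isChain
  rw [List.pairwise_iff_getElem] at *
  intro i j hi hj hij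
  simp only [List.length_zipWith, lt_inf_iff] at hi hj
  simp only [List.getElem_zipWith]
  have h1 := hys i j hi.1 hj.1 hij
  have h2 := ho3 i j hi.2 hj.2 hij
  have h3 := ho2 _ (List.getElem_mem hi.2)
  refine ⟨by omega, ?_⟩
  rw [← drop_win, ← drop_win, hw _ (List.getElem_mem hi.1), hw _ (List.getElem_mem hj.1)]
  exact h2

theorem card_occurrences_lt {W v : List α} {n K : ℕ} (hn : 0 < n) (hnK : n ≤ K)
    (hW : ¬ ListNDivisible n W) (hv : TailsComparable n v) (s : Finset ℕ)
    (hmod : ∀ x ∈ s, ∀ y ∈ s, x % K = y % K) (hw : ∀ y ∈ s, win W K y = v) : s.card < n := by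
  by_contra hlt
  apply hW
  have hlen : n ≤ (s.sort (· ≤ ·)).length := by rw [Finset.length_sort]; omega
  have hmem : ∀ y ∈ (s.sort (· ≤ ·)).take n, y ∈ s := fun y hy =>
    (Finset.mem_sort _).1 (List.mem_of_mem_take hy)
  refine listNDivisible_of_occurrences hn hnK hv ((s.sort (· ≤ ·)).take n) (by simp; omega) ?_
    fun y hy => hw y (hmem y hy)
  have hp : ((s.sort (· ≤ ·)).take n).Pairwise (· < ·) :=
    (Finset.sortedLT_sort s).pairwise.sublist (List.take_sublist _ _)
  refine hp.imp_of_mem ?_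
  intro a b ha hb hab
  have h := Nat.sub_mod_eq_zero_of_mod_eq (hmod b (hmem b hb) a (hmem a ha))
  have := Nat.le_of_dvd (by omega) (Nat.dvd_of_mod_eq_zero h)
  omega

end Coloring

/-! ### Local periods and the powers they produce. -/

section Periodicity

variable {α : Type*}

/-- `p` is a period of the factor of length `m` of `W` at the position `x`. -/
def HasPeriod (W : List α) (x m p : ℕ) : Prop :=
  ∀ z, x ≤ z → z + p < x + m → W[z]? = W[z + p]?

/-- The position `x` starts a factor of length `2 n - 1` with a period less than `n`. -/
def PeriodicAt (n : ℕ) (W : List α) (x : ℕ) : Prop :=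
  x + (2 * n - 1) ≤ W.length ∧ ∃ p, 1 ≤ p ∧ p < n ∧ HasPeriod W x (2 * n - 1) p

/-- The period `p` of the first factor survives. The factor starting one place further right has
some period `q`; the new letter is compared with the one `p` before it by going back `q`, then
moving by `p`, then forward `q`. -/
theorem exists_hasPeriod_of_run {n : ℕ} {W : List α} (x r : ℕ)
    (h : ∀ z, x ≤ z → z ≤ x + r → PeriodicAt n W z) :
    ∃ p, 1 ≤ p ∧ p < n ∧ HasPeriod W x (2 * n - 1 + r) p := by
  induction r with
  | zero => exact (h x le_rfl le_rfl).2
  | succ r ih =>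
    obtain ⟨p, hp1, hpn, hp⟩ := ih fun z h1 h2 => h z h1 (by omega)
    obtain ⟨-, q, hq1, hqn, hq⟩ := h (x + (r + 1)) (by omega) le_rfl
    refine ⟨p, hp1, hpn, fun z hz1 hz2 => ?_⟩
    by_cases hz : z + p < x + (2 * n - 1 + r)
    · exact hp z hz1 hz
    -- Since `p + q ≤ 2n - 2`, the place `t` still lies in the last factor; this is what the length
    -- `2n - 1` is for.
    · obtain ⟨t, rfl⟩ : ∃ t, z = t + q := ⟨z - q, by omega⟩
      have e1 := hq t (by omega) (by omega)
      have e2 := hp t (by omega) (by omega)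
      have e3 := hq (t + p) (by omega) (by omega)
      rw [← e1, e2, e3]
      congr 1; omega

theorem eq_pow_mul_of_period {y : List α} (hy : 0 < y.length) (u : List α)
    (hu : ∀ z, z + y.length < u.length → u[z]? = u[z + y.length]?)
    (huy : ∀ z, z < u.length → z < y.length → u[z]? = y[z]?) :
    ∃ k r : ℕ, FreeMonoid.ofList u = FreeMonoid.ofList y ^ k * FreeMonoid.ofList (y.take r) := by
  induction hm : u.length using Nat.strong_induction_on generalizing u with
  | _ m ih =>
    subst hm
    by_cases hlt : u.length < y.length
    · refine ⟨0, u.length, ?_⟩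
      rw [pow_zero, one_mul]
      congr 1
      apply List.ext_getElem?
      intro i
      rw [List.getElem?_take]
      split_ifs with h
      · exact huy i h (by omega)
      · exact List.getElem?_eq_none (by omega)
    · have htake : u.take y.length = y := by
        apply List.ext_getElem?
        intro i
        rw [List.getElem?_take]
        split_ifs with h
        · exact huy i (by omega) h
        · exact (List.getElem?_eq_none (by omega)).symm
      obtain ⟨k, r, hkr⟩ := ih (u.drop y.length).length (by rw [List.length_drop]; omega)
        (u.drop y.length)
        (fun z hz => by
          rw [List.length_drop] at hz
          rw [List.getElem?_drop, List.getElem?_drop, ← add_assoc]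
          exact hu _ (by omega))
        (fun z hz hz' => by
          rw [List.length_drop] at hz
          rw [List.getElem?_drop, add_comm, ← hu z (by omega)]
          exact huy z (by omega) hz') rfl
      refine ⟨k + 1, r, ?_⟩
      rw [pow_succ', mul_assoc, ← hkr, ← FreeMonoid.ofList_append]
      conv_lhs => rw [← List.take_append_drop y.length u, htake]

theorem exists_short_pow_mul_of_hasPeriod {n : ℕ} {W : List α} {x m p : ℕ} (hp1 : 1 ≤ p)
    (hpn : p < n) (h : HasPeriod W x m p) (k : ℕ) (hk : k ≤ m) :
    ∃ y ∈ shortWords α n, ∃ y' ∈ shortWords α n, ∃ j : ℕ,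
      FreeMonoid.ofList (win W k x) = y ^ j * y' := by
  by_cases hlt : (win W k x).length < n
  · exact ⟨1, by simp [shortWords]; omega, FreeMonoid.ofList (win W k x), hlt, 0,
      by rw [pow_zero, one_mul]⟩
  set u := win W k x with hu
  have hlk : u.length ≤ k := by simp [hu, win]
  have hyl : (u.take p).length = p := by rw [List.length_take]; omega
  obtain ⟨j, r, hjr⟩ := eq_pow_mul_of_period (y := u.take p) (by omega) u
    (fun z hz => by
      rw [hyl] at hz ⊢
      rw [hu, getElem?_win (by omega), getElem?_win (by omega), ← add_assoc]
      exact h _ (by omega) (by omega))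
    (fun z hz hz' => by
      rw [hyl] at hz'
      rw [List.getElem?_take, if_pos hz'])
  refine ⟨_, ?_, _, ?_, j, hjr⟩
  · change (u.take p).length < n
    omega
  · change ((u.take p).take r).length < n
    rw [List.length_take]; omega

end Periodicity

section PowProducts

variable {M : Type*} [Monoid M] {Y : Set M}

theorem one_mem_powProducts (Y : Set M) : (1 : M) ∈ powProducts Y 0 :=
  ⟨[], by simp, by simp, by simp⟩

theorem powProducts_mono {h k : ℕ} (hk : h ≤ k) : powProducts Y h ⊆ powProducts Y k := by
  rintro x ⟨L, h1, h2, h3⟩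
  exact ⟨L, h1.trans hk, h2, h3⟩

theorem pow_mul_mem_powProducts {y x : M} {h : ℕ} (hy : y ∈ Y) (k : ℕ)
    (hx : x ∈ powProducts Y h) : y ^ k * x ∈ powProducts Y (h + 1) := by
  obtain ⟨L, h1, h2, rfl⟩ := hx
  refine ⟨(y, k) :: L, by simpa using h1, ?_, by simp⟩
  intro p hp
  rcases List.mem_cons.1 hp with rfl | hp
  · exact hy
  · exact h2 p hp

theorem mul_mem_powProducts {y x : M} {h : ℕ} (hy : y ∈ Y)
    (hx : x ∈ powProducts Y h) : y * x ∈ powProducts Y (h + 1) := by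
  simpa using pow_mul_mem_powProducts hy 1 hx

end PowProducts

/-! ### Height in terms of the number of aperiodic positions. -/

section Height

variable {α : Type*}

open Classical in
/-- The positions that do not start a long periodic factor. -/
noncomputable def aperiodicPositions (n : ℕ) (W : List α) : Finset ℕ :=
  (range W.length).filter fun x => ¬ PeriodicAt n W x

/-- Each aperiodic position costs three blocks: the power and the remainder that make up the
periodic run before it, and its own letter. -/
theorem drop_mem_powProducts {n : ℕ} (hn : 2 ≤ n) (W : List α) (x : ℕ) :
    FreeMonoid.ofList (W.drop x) ∈ powProducts (shortWords α n)
      (3 * ((aperiodicPositions n W).filter (x ≤ ·)).card) := by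
  induction hm : W.length - x using Nat.strong_induction_on generalizing x with
  | _ m ih =>
    subst hm
    by_cases hx : W.length ≤ x
    · rw [List.drop_eq_nil_of_le hx]
      exact powProducts_mono (Nat.zero_le _) (one_mem_powProducts _)
    push Not at hx
    classical
    have hex : ∃ y, x ≤ y ∧ y ∈ aperiodicPositions n W := by
      -- The last position is aperiodic because no factor of length `2n - 1` fits there.
      refine ⟨W.length - 1, by omega, ?_⟩
      simp only [aperiodicPositions, Finset.mem_filter, Finset.mem_range, PeriodicAt, not_and_or]
      exact ⟨by omega, Or.inl (by omega)⟩
    set y := Nat.find hex with hy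
    obtain ⟨hxy, hyB⟩ : x ≤ y ∧ y ∈ aperiodicPositions n W := Nat.find_spec hex
    have hyN : y < W.length := by
      simp only [aperiodicPositions, Finset.mem_filter, Finset.mem_range] at hyB
      exact hyB.1
    have hgood : ∀ z, x ≤ z → z < y → PeriodicAt n W z := by
      intro z hz hzy
      have := Nat.find_min hex hzy
      by_contra hcon
      exact this ⟨hz, by simp [aperiodicPositions, hcon]; omega⟩
    have hcard : ((aperiodicPositions n W).filter (y + 1 ≤ ·)).card + 1 ≤
        ((aperiodicPositions n W).filter (x ≤ ·)).card := by
      apply Finset.card_lt_card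
      rw [Finset.ssubset_iff_of_subset]
      · exact ⟨y, by simp [hyB, hxy], by simp⟩
      · intro w hw
        simp only [Finset.mem_filter] at *
        exact ⟨hw.1, by omega⟩
    have htail := ih (W.length - (y + 1)) (by omega) (y + 1) rfl
    have hletter : FreeMonoid.of W[y] ∈ shortWords α n := by
      simp only [shortWords, Set.mem_ofPred_eq, FreeMonoid.length_of]; omega
    have hy' : FreeMonoid.ofList (W.drop y) =
        FreeMonoid.of W[y] * FreeMonoid.ofList (W.drop (y + 1)) := by
      rw [List.drop_eq_getElem_cons hyN]; rfl
    have h1 : FreeMonoid.ofList (W.drop y) ∈ powProducts (shortWords α n)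
        (3 * ((aperiodicPositions n W).filter (y + 1 ≤ ·)).card + 1) := by
      rw [hy']
      exact mul_mem_powProducts hletter htail
    rcases hxy.eq_or_lt with hxy' | hxy'
    · rw [hxy']
      rw [hxy'] at hcard
      exact powProducts_mono (by omega) h1
    · obtain ⟨p, hp1, hpn, hp⟩ := exists_hasPeriod_of_run (n := n) (W := W) x (y - x - 1)
        fun z h1 h2 => hgood z h1 (by omega)
      obtain ⟨u, hu, u', hu', j, huj⟩ :=
        exists_short_pow_mul_of_hasPeriod hp1 hpn hp (y - x) (by omega)
      have : FreeMonoid.ofList (W.drop x) = u ^ j * (u' * FreeMonoid.ofList (W.drop y)) := by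
        rw [← mul_assoc, ← huj, ← FreeMonoid.ofList_append]
        congr 1
        have := win_append_drop W (y - x) x
        rw [← this]
        congr 2; omega
      rw [this]
      exact powProducts_mono (by omega)
        (pow_mul_mem_powProducts hu j (mul_mem_powProducts hu' h1))

theorem mem_powProducts_aperiodicPositions {n : ℕ} (hn : 2 ≤ n) (W : List α) :
    FreeMonoid.ofList W ∈ powProducts (shortWords α n) (3 * (aperiodicPositions n W).card) := by
  simpa using drop_mem_powProducts hn W 0

/-- If the tails at `i < j` are incomparable, the shorter is a prefix of the longer, so the window
has period `j - i < n` from offset `i` on. As `K ≥ 3n`, this stretch contains the factor of length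
`2n - 1` at offset `n - 1`. -/
theorem tailsComparable_of_not_periodicAt [LinearOrder α] {n K : ℕ} {W : List α} {y : ℕ}
    (hK : 3 * n ≤ K) (hy : y + K ≤ W.length)
    (h : ¬ PeriodicAt n W (y + (n - 1))) : TailsComparable n (win W K y) := by
  intro i j hij hjn
  by_contra hcon
  push Not at hcon
  have hlen := length_win hy
  have hpre : (win W K y).drop j <+: (win W K y).drop i := by
    rcases listGT_trichotomy ((win W K y).drop i) ((win W K y).drop j) with h1 | h1 | h1 | h1
    · exact absurd h1 hcon.1
    · exact absurd h1 hcon.2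
    · have := h1.length_le
      rw [List.length_drop, List.length_drop] at this
      omega
    · exact h1
  apply h
  refine ⟨by omega, j - i, by omega, by omega, fun z hz1 hz2 => ?_⟩
  obtain ⟨t, ht⟩ := hpre
  have hz := congrArg (fun l => l[z - y - i]?) ht
  rw [List.getElem?_append_left (by rw [List.length_drop]; omega), List.getElem?_drop,
    List.getElem?_drop, getElem?_win (by omega), getElem?_win (by omega)] at hz
  rw [show y + (j + (z - y - i)) = z + (j - i) by omega,
    show y + (i + (z - y - i)) = z by omega] at hz
  exact hz.symm

end Height

/-! ### The count of aperiodic positions. -/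

section Bound

variable {α : Type*} [LinearOrder α] [Fintype α]

theorem card_color_image_le {n K s : ℕ} (hn : 2 ≤ n) (hK : K = 2 ^ s) {W : List α}
    (hW : ¬ ListNDivisible n W) (hKW : K ≤ W.length) (i : ℕ) (hi : i ≤ s) :
    ((range (W.length + 1 - K)).image fun x =>
      ((x % K, decRank W K x), win W (2 ^ i) x)).card ≤
      ((K * (n - 1)) ^ 2 + 2 * K) ^ i * (K * (n - 1) * Fintype.card α) := by
  have hK0 : 0 < K := by rw [hK]; positivity
  set M := W.length + 1 - K with hM
  have hrank : ∀ x, x < M → decRank W K x < n - 1 := fun x hx =>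
    decRank_lt_of_not_listNDivisible hn hW (by omega)
  have hpow : ∀ j, j ≤ s → 2 ^ j ≤ K := fun j hj => by
    rw [hK]; exact Nat.pow_le_pow_right (by norm_num) hj
  induction i with
  | zero =>
    calc _ ≤ ((range K ×ˢ range (n - 1)) ×ˢ
          (Finset.univ : Finset α).image fun a => [a]).card := by
          apply Finset.card_le_card
          intro t ht
          obtain ⟨x, hx, rfl⟩ := Finset.mem_image.1 ht
          have hx := Finset.mem_range.1 hx
          simp only [Finset.mem_product, Finset.mem_range, Finset.mem_image, Finset.mem_univ,
            true_and]
          refine ⟨⟨Nat.mod_lt _ hK0, hrank x hx⟩, ?_⟩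
          have : (win W (2 ^ 0) x).length = 1 := length_win (by rw [pow_zero]; omega)
          obtain ⟨a, ha⟩ := List.length_eq_one_iff.1 this
          exact ⟨a, ha.symm⟩
      _ ≤ _ := by
          rw [Finset.card_product, Finset.card_product, Finset.card_range, Finset.card_range,
            pow_zero, one_mul]
          exact Nat.mul_le_mul_left _ Finset.card_image_le
  | succ i ih =>
    have ih := ih (by omega)
    have : NeZero K := ⟨by omega⟩
    have : NeZero (n - 1) := ⟨by omega⟩
    -- The same colours in a finite type, to have `K * (n - 1)` as its cardinality; below `M` the
    -- reduction modulo `n - 1` changes nothing.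
    let c : ℕ → Fin K × Fin (n - 1) := fun x => (Fin.ofNat K x, Fin.ofNat (n - 1) (decRank W K x))
    have hc : ∀ x, x < M → ∀ y, y < M →
        (c x = c y ↔ x % K = y % K ∧ decRank W K x = decRank W K y) := by
      intro x hx y hy
      simp [c, Fin.ext_iff, Nat.mod_eq_of_lt (hrank x hx), Nat.mod_eq_of_lt (hrank y hy)]
    have hstep := card_image_color_pair_le M (2 ^ i) (by omega) c (win W (2 ^ i))
      (win W (2 ^ (i + 1)))
      (fun x y hxy hy hcxy => by
        rw [hc x (by omega) y hy] at hcxy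
        -- A descent between congruent positions would raise the rank, contrary to equal colours.
        -- The full windows therefore increase, and so do their prefixes of length `2 ^ i`.
        have hle : win W K x ≤ win W K y := by
          by_contra hlt
          have := decRank_lt hxy hcxy.1 (not_le.1 hlt)
          omega
        have := take_le_take hle (by rw [length_win (by omega), length_win (by omega)]) (2 ^ i)
        rwa [take_win (hpow i (by omega)), take_win (hpow i (by omega))] at this)
      (fun x y h1 h2 => by
        rw [pow_succ, mul_two, win_add, win_add, h1, h2])
    have hcongr : ∀ j, ((range M).image fun x => ((x % K, decRank W K x), win W (2 ^ j) x)).card =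
        ((range M).image fun x => (c x, win W (2 ^ j) x)).card := by
      intro j
      apply le_antisymm <;> apply card_image_le_card_image <;> intro x hx y hy hxy <;>
        simp only [Prod.mk.injEq] at hxy ⊢ <;>
        have hcx := hc x (Finset.mem_range.1 hx) y (Finset.mem_range.1 hy)
      · exact ⟨hcx.1 hxy.1, hxy.2⟩
      · exact ⟨hcx.2 hxy.1, hxy.2⟩
    rw [hcongr] at ih ⊢
    refine hstep.trans ?_
    rw [Fintype.card_prod, Fintype.card_fin, Fintype.card_fin, pow_succ' _ i, mul_assoc (_ + _)]
    have := hpow i (by omega)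
    gcongr
    refine le_trans (le_of_eq ?_) ih
    congr!

theorem card_aperiodicPositions_le {n K s : ℕ} (hn : 2 ≤ n) (hK : K = 2 ^ s) (hnK : 3 * n ≤ K)
    {W : List α} (hW : ¬ ListNDivisible n W) :
    (aperiodicPositions n W).card ≤ K + (n - 1) *
      (((K * (n - 1)) ^ 2 + 2 * K) ^ s * (K * (n - 1) * Fintype.card α)) := by
  classical
  by_cases hKW : K ≤ W.length
  swap
  · have : (aperiodicPositions n W).card ≤ W.length := by
      rw [aperiodicPositions]
      exact (Finset.card_filter_le _ _).trans (Finset.card_range _).le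
    omega
  have hcol := card_color_image_le hn hK hW hKW s le_rfl
  rw [← hK] at hcol
  set M := W.length + 1 - K with hM
  set T := (range M).filter fun y => TailsComparable n (win W K y) with hT
  -- Shifting back by `n - 1` loses only positions near the two ends, fewer than `K` in all.
  have hsub : aperiodicPositions n W ⊆
      (range (n - 1) ∪ Finset.Ico (M + (n - 1)) W.length) ∪ T.image (· + (n - 1)) := by
    intro x hx
    simp only [aperiodicPositions, Finset.mem_filter, Finset.mem_range] at hx
    simp only [Finset.mem_union, Finset.mem_range, Finset.mem_Ico, Finset.mem_image]
    by_cases h1 : x < n - 1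
    · exact Or.inl (Or.inl h1)
    by_cases h2 : M + (n - 1) ≤ x
    · exact Or.inl (Or.inr ⟨h2, hx.1⟩)
    refine Or.inr ⟨x - (n - 1), ?_, by omega⟩
    simp only [hT, Finset.mem_filter, Finset.mem_range]
    refine ⟨by omega, tailsComparable_of_not_periodicAt hnK (by omega) ?_⟩
    rw [show x - (n - 1) + (n - 1) = x by omega]
    exact hx.2
  have hTcard : T.card ≤ (n - 1) *
      (T.image fun x => ((x % K, decRank W K x), win W K x)).card := by
    apply Finset.card_le_mul_card_image
    intro a ha
    obtain ⟨x, hx, rfl⟩ := Finset.mem_image.1 ha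
    have hxT := (Finset.mem_filter.1 hx).2
    have := card_occurrences_lt (n := n) (K := K) (by omega) (by omega) hW hxT
      (T.filter fun y => ((y % K, decRank W K y), win W K y) =
        ((x % K, decRank W K x), win W K x))
      (fun y hy z hz => by
        simp only [Finset.mem_filter, Prod.mk.injEq] at hy hz
        rw [hy.2.1.1, hz.2.1.1])
      (fun y hy => by
        simp only [Finset.mem_filter, Prod.mk.injEq] at hy
        exact hy.2.2)
    omega
  have hTimg : (T.image fun x => ((x % K, decRank W K x), win W K x)).card ≤
      ((range M).image fun x => ((x % K, decRank W K x), win W K x)).card :=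
    Finset.card_le_card (Finset.image_subset_image (Finset.filter_subset _ _))
  calc _ ≤ _ := Finset.card_le_card hsub
    _ ≤ ((n - 1) + (W.length - (M + (n - 1)))) + T.card := by
      refine (Finset.card_union_le _ _).trans (Nat.add_le_add ?_ Finset.card_image_le)
      refine (Finset.card_union_le _ _).trans ?_
      simp
    _ ≤ K + (n - 1) * (T.image fun x => ((x % K, decRank W K x), win W K x)).card := by
      refine Nat.add_le_add (by omega) hTcard
    _ ≤ _ := by
      gcongr
      exact hTimg.trans hcol

end Bound

end Shirshov

namespace Shirshov

/-! ### Comparison of the bound obtained with `Phi`. -/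

section Numeric

theorem logb_three_pos {n : ℕ} (hn : 2 ≤ n) : 0 < Real.logb 3 n :=
  Real.logb_pos (by norm_num) (by exact_mod_cast hn)

theorem one_third_le_logb {n : ℕ} (hn : 2 ≤ n) : 1 / 3 ≤ Real.logb 3 n := by
  rw [Real.le_logb_iff_rpow_le (by norm_num) (by positivity)]
  calc (3 : ℝ) ^ (1 / 3 : ℝ) ≤ 8 ^ (1 / 3 : ℝ) := by gcongr; norm_num
    _ = 2 := by
      rw [show (8 : ℝ) = 2 ^ (3 : ℝ) by norm_num, ← Real.rpow_mul (by norm_num)]; norm_num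
    _ ≤ n := by exact_mod_cast hn

theorem neg_one_le_logb_logb {n : ℕ} (hn : 2 ≤ n) : -1 ≤ Real.logb 3 (Real.logb 3 n) := by
  rw [Real.le_logb_iff_rpow_le (by norm_num) (logb_three_pos hn), Real.rpow_neg_one]
  simpa using one_third_le_logb hn

/-- Take logarithms and use `3 ≤ 2 ^ 2`, that is, `log₂ 3 ≤ 2`. -/
theorem le_of_two_pow_le {n s : ℕ} (hn : 2 ≤ n) (hs : 2 ^ s ≤ 8 * n) :
    (s : ℝ) ≤ 3 + 2 * Real.logb 3 n := by
  have hlog2 : 0 < Real.log 2 := Real.log_pos (by norm_num)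
  have hn0 : (0 : ℝ) < n := by exact_mod_cast (by omega : 0 < n)
  have h1 : s * Real.log 2 ≤ 3 * Real.log 2 + Real.log n := by
    have h : ((2 : ℝ) ^ s) ≤ 2 ^ 3 * n := by
      have : ((2 ^ s : ℕ) : ℝ) ≤ ((8 * n : ℕ) : ℝ) := by exact_mod_cast hs
      push_cast at this
      linarith
    have := Real.log_le_log (by positivity) h
    rw [Real.log_pow, Real.log_mul (by positivity) hn0.ne', Real.log_pow] at this
    exact_mod_cast this
  have h3 : Real.log 3 ≤ 2 * Real.log 2 := by
    have : Real.log 3 ≤ Real.log (2 ^ 2) := Real.log_le_log (by norm_num) (by norm_num)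
    rw [Real.log_pow] at this
    exact_mod_cast this
  have h4 : Real.log n = Real.logb 3 n * Real.log 3 := by
    rw [Real.logb, div_mul_cancel₀]
    exact (Real.log_pos (by norm_num)).ne'
  have h5 : Real.logb 3 n * Real.log 3 ≤ Real.logb 3 n * (2 * Real.log 2) :=
    mul_le_mul_of_nonneg_left h3 (logb_three_pos hn).le
  have : s * Real.log 2 ≤ (3 + 2 * Real.logb 3 n) * Real.log 2 := by
    rw [h4] at h1; linarith
  exact le_of_mul_le_mul_right this hlog2

/-- The exponent `9 + 4 s` is at most `21 + 8 log₃ n`. The iterated logarithm in `Phi` is at least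
`-1` even for `n = 2`, so `91 - 36` leaves ample room. -/
theorem pow_mul_le_Phi {n l s : ℕ} (hn : 2 ≤ n) (hs : 2 ^ s ≤ 8 * n) :
    ((2 ^ 21 * l * n ^ 9 * (n ^ s) ^ 4 : ℕ) : ℝ) ≤ Phi n l := by
  have hn1 : (1 : ℝ) ≤ n := by exact_mod_cast (by omega : 1 ≤ n)
  have hn0 : (0 : ℝ) < n := by linarith
  have h1 := le_of_two_pow_le hn hs
  have h2 := neg_one_le_logb_logb hn
  have h3 := logb_three_pos hn
  push_cast
  have : (n : ℝ) ^ 9 * ((n : ℝ) ^ s) ^ 4 = (n : ℝ) ^ (9 + 4 * (s : ℝ)) := by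
    rw [← pow_mul, ← pow_add, ← Real.rpow_natCast]
    congr 1
    push_cast; ring
  rw [mul_assoc, this, Phi]
  have hexp : (n : ℝ) ^ (9 + 4 * (s : ℝ)) ≤ (n : ℝ) ^
      (12 * Real.logb 3 n + 36 * Real.logb 3 (Real.logb 3 n) + 91) :=
    Real.rpow_le_rpow_of_exponent_le hn1 (by linarith)
  gcongr
  norm_num

theorem height_bound_le_pow {n l s K : ℕ} (hn : 2 ≤ n) (hl : 1 ≤ l) (hK : K = 2 ^ s)
    (hK6 : K ≤ 6 * n) (hK0 : 1 ≤ K) :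
    3 * (K + (n - 1) * (((K * (n - 1)) ^ 2 + 2 * K) ^ s * (K * (n - 1) * l))) ≤
      2 ^ 21 * l * n ^ 9 * (n ^ s) ^ 4 := by
  have h1 : (K * (n - 1)) ^ 2 + 2 * K ≤ 2 ^ 6 * n ^ 4 := by
    obtain ⟨m, rfl⟩ : ∃ m, n = m + 2 := ⟨n - 2, by omega⟩
    have e1 : (K * (m + 2 - 1)) ^ 2 + 2 * K ≤ (K * (m + 2)) ^ 2 := by
      rw [show m + 2 - 1 = m + 1 by omega]
      nlinarith [Nat.mul_le_mul hK0 hK0, Nat.zero_le (K * K * m)]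
    calc _ ≤ (K * (m + 2)) ^ 2 := e1
      -- The factor 6 is weakened to 8 so that the constant is `2 ^ 6`, whose `s`-th power is `K ^
      -- 6`, again polynomial in `n`.
      _ ≤ (8 * (m + 2) * (m + 2)) ^ 2 := by gcongr; omega
      _ = _ := by ring
  have h2 : ((K * (n - 1)) ^ 2 + 2 * K) ^ s ≤ 6 ^ 6 * n ^ 6 * (n ^ s) ^ 4 := by
    calc _ ≤ (2 ^ 6 * n ^ 4) ^ s := Nat.pow_le_pow_left h1 s
      _ = (2 ^ s) ^ 6 * (n ^ s) ^ 4 := by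
        rw [mul_pow, pow_right_comm 2 6 s, pow_right_comm n 4 s]
      _ ≤ (6 * n) ^ 6 * (n ^ s) ^ 4 := by rw [← hK]; gcongr
      _ = _ := by ring
  have hn1 : 1 ≤ n := by omega
  have h3 : 1 ≤ n ^ s := Nat.one_le_pow _ _ hn1
  calc _ ≤ 3 * (6 * n + n * (6 ^ 6 * n ^ 6 * (n ^ s) ^ 4 * (6 * n * n * l))) := by
        gcongr <;> omega
    _ = 18 * n + 18 * 6 ^ 6 * n ^ 9 * (n ^ s) ^ 4 * l := by ring
    _ ≤ 18 * (n ^ 9 * (n ^ s) ^ 4 * l) + 18 * 6 ^ 6 * n ^ 9 * (n ^ s) ^ 4 * l := by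
        gcongr
        calc n = n ^ 1 * 1 ^ 4 * 1 := by ring
          _ ≤ n ^ 9 * (n ^ s) ^ 4 * l := by gcongr; norm_num
    _ = (18 + 18 * 6 ^ 6) * (n ^ 9 * (n ^ s) ^ 4 * l) := by ring
    _ ≤ 2 ^ 21 * (n ^ 9 * (n ^ s) ^ 4 * l) := by gcongr; norm_num
    _ = _ := by ring

end Numeric

/-- Words that are not `n`-divisible are products of few powers of short words. -/
theorem exists_height_bound {n : ℕ} (hn : 2 ≤ n) (l : ℕ) :
    ∃ k : ℕ, {W : FreeMonoid (Fin l) | ¬ NDivisible n W} ⊆ powProducts (shortWords (Fin l) n) k ∧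
      (k : ℝ) ≤ Phi n l := by
  rcases Nat.eq_zero_or_pos l with rfl | hl
  · refine ⟨0, fun W _ => ?_, by simp [Phi]⟩
    have : W = 1 := by
      apply FreeMonoid.toList.injective
      cases h : W.toList with
      | nil => rfl
      | cons a _ => exact a.elim0
    rw [this]
    exact one_mem_powProducts _
  -- The least power of two that is at least `3n`; by minimality it is at most `6n`.
  · set s := Nat.clog 2 (3 * n) with hs
    have h1 : 3 * n ≤ 2 ^ s := Nat.le_pow_clog (by norm_num) _
    have h2 : 2 ^ s ≤ 6 * n := by
      have h := Nat.pow_pred_clog_lt_self (b := 2) (by norm_num) (x := 3 * n) (by omega)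
      have hs0 : 0 < s := Nat.clog_pos (by norm_num) (by omega)
      rw [← hs] at h
      obtain ⟨t, ht⟩ : ∃ t, s = t + 1 := ⟨s - 1, by omega⟩
      rw [ht] at h ⊢
      simp only [Nat.pred_eq_sub_one, Nat.add_sub_cancel] at h
      rw [pow_succ]; omega
    refine ⟨3 * (2 ^ s + (n - 1) *
      (((2 ^ s * (n - 1)) ^ 2 + 2 * 2 ^ s) ^ s * (2 ^ s * (n - 1) * l))), fun W hW => ?_, ?_⟩
    · have hW' : ¬ ListNDivisible n W.toList := fun h => hW (nDivisible_ofList_iff.2 h)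
      have hc := card_aperiodicPositions_le hn rfl h1 hW'
      rw [Fintype.card_fin] at hc
      exact powProducts_mono (Nat.mul_le_mul_left 3 hc)
        (mem_powProducts_aperiodicPositions hn W.toList)
    · refine le_trans ?_ (pow_mul_le_Phi hn (by omega : 2 ^ s ≤ 8 * n))
      exact_mod_cast height_bound_le_pow hn hl rfl h2 (by omega)

theorem exists_isLeast_le {P : ℕ → Prop} {k : ℕ} (hk : P k) :
    ∃ h : ℕ, IsLeast {j | P j} h ∧ h ≤ k := by
  classical
  have hex : ∃ j, P j := ⟨k, hk⟩
  exact ⟨Nat.find hex, ⟨Nat.find_spec hex, fun j hj => Nat.find_min' hex hj⟩,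
    Nat.find_min' hex hk⟩

/-! ### Growth of `Phi`. -/

section Asymptotics

open Filter Topology Asymptotics

theorem Phi_eq_mul (n l : ℕ) : Phi n l = l * Phi n 1 := by
  simp only [Phi, Nat.cast_one]; ring

theorem Phi_nonneg (n l : ℕ) : 0 ≤ Phi n l := by
  unfold Phi; positivity

theorem tendsto_logb_natCast : Tendsto (fun n : ℕ => Real.logb 3 n) atTop atTop :=
  (Real.tendsto_logb_atTop (by norm_num)).comp tendsto_natCast_atTop_atTop

/-- The constant `C = 2 ^ 96 * l` is `n ^ (log₃ C / log₃ n)`; `ε` is found by solving for the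
exponent, and its terms tend to zero with `x = log₃ n`. -/
theorem exists_Phi_eq_rpow {l : ℕ} (hl : 1 ≤ l) :
    ∃ ε : ℕ → ℝ, Tendsto ε atTop (𝓝 0) ∧
      ∀ n : ℕ, 2 ≤ n → Phi n l = (n : ℝ) ^ (12 * (1 + ε n) * Real.logb 3 n) := by
  have hl0 : (0 : ℝ) < l := by exact_mod_cast hl
  have hC : (0 : ℝ) < 2 ^ 96 * l := by positivity
  refine ⟨fun n => (Real.logb 3 (2 ^ 96 * l) / Real.logb 3 n +
    36 * Real.logb 3 (Real.logb 3 n) + 91) / (12 * Real.logb 3 n), ?_, ?_⟩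
  · have key : Tendsto (fun x : ℝ => (Real.logb 3 (2 ^ 96 * l) / x +
        36 * Real.logb 3 x + 91) / (12 * x)) atTop (𝓝 0) := by
      have h1 : Tendsto (fun x : ℝ => Real.logb 3 (2 ^ 96 * l) / 12 * (x⁻¹ * x⁻¹)) atTop (𝓝 0) := by
        simpa using (tendsto_inv_atTop_zero.mul tendsto_inv_atTop_zero).const_mul
          (Real.logb 3 (2 ^ 96 * l) / 12)
      have h2 : Tendsto (fun x : ℝ => 3 / Real.log 3 * (Real.log x / x)) atTop (𝓝 0) := by
        simpa using (Real.isLittleO_log_id_atTop.tendsto_div_nhds_zero).const_mul (3 / Real.log 3)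
      have h3 : Tendsto (fun x : ℝ => (91 / 12 : ℝ) * x⁻¹) atTop (𝓝 0) := by
        simpa using tendsto_inv_atTop_zero.const_mul (91 / 12 : ℝ)
      have h := (h1.add h2).add h3
      simp only [add_zero] at h
      refine h.congr' ?_
      filter_upwards [eventually_gt_atTop 0] with x hx
      have : Real.log 3 ≠ 0 := (Real.log_pos (by norm_num)).ne'
      rw [Real.logb, Real.logb]
      field_simp
      ring
    exact key.comp tendsto_logb_natCast
  · intro n hn
    have hL := logb_three_pos hn
    have hn0 : (0 : ℝ) < n := by exact_mod_cast (by omega : 0 < n)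
    have hexp : 12 * (1 + (Real.logb 3 (2 ^ 96 * l) / Real.logb 3 n +
        36 * Real.logb 3 (Real.logb 3 n) + 91) / (12 * Real.logb 3 n)) * Real.logb 3 n =
        Real.logb 3 (2 ^ 96 * l) / Real.logb 3 n +
        (12 * Real.logb 3 n + 36 * Real.logb 3 (Real.logb 3 n) + 91) := by
      field_simp
      ring
    rw [hexp, Real.rpow_add hn0, Phi]
    congr 1
    have : Real.logb 3 (2 ^ 96 * l) / Real.logb 3 n = Real.logb n (2 ^ 96 * l) := by
      have : Real.log 3 ≠ 0 := (Real.log_pos (by norm_num)).ne'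
      simp only [Real.logb]
      field_simp
    rw [this, Real.rpow_logb hn0 (by exact_mod_cast (by omega : n ≠ 1)) hC]

/-- For `n ≥ 3` both `log₃ n` and its iterate are at most `log n`, and `log n ≥ 1`; `139 = 12 + 36 +
91`. -/
theorem Phi_le_exp {n : ℕ} (hn : 3 ≤ n) (l : ℕ) :
    Phi n l ≤ 2 ^ 96 * l * Real.exp (139 * Real.log n ^ 2) := by
  have hn0 : (0 : ℝ) < n := by exact_mod_cast (by omega : 0 < n)
  have h3 : (3 : ℝ) ≤ n := by exact_mod_cast hn
  have hlog3 : 1 ≤ Real.log 3 := by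
    rw [Real.le_log_iff_exp_le (by norm_num)]
    exact Real.exp_one_lt_d9.le.trans (by norm_num)
  have hlog : 1 ≤ Real.log n := hlog3.trans (Real.log_le_log (by norm_num) h3)
  have hL0 := logb_three_pos (by omega : 2 ≤ n)
  have hLle : Real.logb 3 n ≤ Real.log n := div_le_self (by linarith) hlog3
  have hLL : Real.logb 3 (Real.logb 3 n) ≤ Real.log n := by
    have hL1 : 1 ≤ Real.logb 3 n := by
      rw [Real.le_logb_iff_rpow_le (by norm_num) hn0, Real.rpow_one]; exact h3
    have : 0 ≤ Real.log (Real.logb 3 n) := Real.log_nonneg hL1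
    calc _ ≤ Real.log (Real.logb 3 n) := div_le_self this hlog3
      _ ≤ Real.logb 3 n - 1 := Real.log_le_sub_one_of_pos hL0
      _ ≤ _ := by linarith
  unfold Phi
  rw [Real.rpow_def_of_pos hn0]
  gcongr 2 ^ 96 * (l : ℝ) * Real.exp ?_
  nlinarith

/-- Everything is `exp (O(log² n))`, hence below `c ^ (n / 2)` up to a constant. The factor `n ^ j`
serves the nilpotency bound. -/
theorem pow_mul_Phi_isLittleO (j l : ℕ) {c : ℝ} (hc : 1 < c) :
    (fun n : ℕ => (n : ℝ) ^ j * Phi n l) =o[atTop] fun n : ℕ => c ^ n := by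
  have hlogc : 0 < Real.log c := Real.log_pos hc
  have hlog2 : (fun n : ℕ => (139 + j) * Real.log n ^ 2) =o[atTop] fun n : ℕ => (n : ℝ) :=
    ((Real.isLittleO_pow_log_id_atTop (n := 2)).comp_tendsto
      tendsto_natCast_atTop_atTop).const_mul_left _
  have hO : (fun n : ℕ => (n : ℝ) ^ j * Phi n l) =O[atTop]
      fun n : ℕ => Real.exp (Real.log c / 2 * n) := by
    apply IsBigO.of_bound (2 ^ 96 * l)
    filter_upwards [hlog2.bound (half_pos hlogc), eventually_ge_atTop 3] with n hn hn3
    have hn0 : (0 : ℝ) < n := by exact_mod_cast (by omega : 0 < n)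
    have hlog : 1 ≤ Real.log n := by
      rw [Real.le_log_iff_exp_le hn0]
      have h3 : (3 : ℝ) ≤ n := by exact_mod_cast hn3
      exact Real.exp_one_lt_d9.le.trans (by norm_num; linarith)
    rw [Real.norm_of_nonneg (by positivity), Real.norm_of_nonneg (by positivity)] at hn
    rw [Real.norm_of_nonneg (mul_nonneg (by positivity) (Phi_nonneg n l)),
      Real.norm_of_nonneg (by positivity)]
    have hpow : (n : ℝ) ^ j ≤ Real.exp (j * Real.log n ^ 2) := by
      rw [← Real.exp_log hn0, ← Real.exp_nat_mul, Real.exp_log hn0]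
      gcongr
      nlinarith
    calc (n : ℝ) ^ j * Phi n l
        ≤ Real.exp (j * Real.log n ^ 2) * (2 ^ 96 * l * Real.exp (139 * Real.log n ^ 2)) :=
          mul_le_mul hpow (Phi_le_exp hn3 l) (Phi_nonneg n l) (by positivity)
      _ = 2 ^ 96 * l * Real.exp ((139 + j) * Real.log n ^ 2) := by
          rw [add_mul, Real.exp_add]; ring
      _ ≤ _ := by gcongr
  refine hO.trans_isLittleO ?_
  have : (fun n : ℕ => c ^ n) = fun n : ℕ => Real.exp (Real.log c * n) := by
    funext n
    rw [mul_comm, Real.exp_nat_mul, Real.exp_log (by linarith)]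
  rw [this, Real.isLittleO_exp_comp_exp_comp]
  have h : (fun n : ℕ => Real.log c * n - Real.log c / 2 * n) =
      fun n : ℕ => Real.log c / 2 * (n : ℝ) := by funext n; ring
  rw [h]
  exact tendsto_natCast_atTop_atTop.const_mul_atTop (half_pos hlogc)

end Asymptotics

end Shirshov

namespace Shirshov

open Finset

/-! ### Linearization of identities by alternating sums. -/

section Linearization

variable {B : Type*} [Ring B]

/-- The alternating sum over `T` of the values of the monomial `v` at
`x_i = ∑ y_j`, where `j` runs over the elements of `T` with `u j = i`. -/
def altProd {d : ℕ} (u : Fin d → ℕ) (y : Fin d → B) (v : List ℕ) : B :=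
  ∑ T : Finset (Fin d), (-1 : ℤ) ^ T.card • (v.map fun i => ∑ j ∈ T with u j = i, y j).prod

/-- Adding or removing a fixed element outside `I` pairs off sets of opposite sign. -/
theorem sum_superset_neg_one_pow_card {ι : Type*} [Fintype ι] [DecidableEq ι] (I : Finset ι) :
    (∑ T : Finset ι with I ⊆ T, (-1 : ℤ) ^ T.card) =
      if I = univ then (-1) ^ Fintype.card ι else 0 := by
  split_ifs with h
  · subst h
    have : (univ.filter fun T : Finset ι => univ ⊆ T) = {univ} := by
      ext T; simp
    rw [this, Finset.sum_singleton, Finset.card_univ]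
  · obtain ⟨j, hj⟩ : ∃ j, j ∉ I := by
      by_contra hcon
      push Not at hcon
      exact h (Finset.eq_univ_iff_forall.2 hcon)
    refine Finset.sum_involution (fun T _ => if j ∈ T then T.erase j else insert j T) ?_ ?_ ?_ ?_
    · intro T _
      split_ifs with hT
      · rw [← Finset.card_erase_add_one hT, pow_succ]; ring
      · rw [Finset.card_insert_of_notMem hT, pow_succ]; ring
    · intro T _ _
      split_ifs with hT
      · intro he; rw [← he] at hT; simp at hT
      · intro he; rw [← he] at hT; simp at hT
    · intro T hT
      simp only [Finset.mem_filter, Finset.mem_univ, true_and] at hT ⊢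
      split_ifs
      · exact Finset.subset_erase.2 ⟨hT, hj⟩
      · exact hT.trans (Finset.subset_insert _ _)
    · intro T _
      by_cases hT : j ∈ T
      · simp [hT]
      · simp [hT]

-- Expand the products into choices `φ` of an index at each place. The choice `φ` occurs for all `T`
-- containing its image, and the signs cancel unless the image is everything.
open Classical in
theorem altProd_ofFn {d e : ℕ} (u : Fin d → ℕ) (y : Fin d → B) (w : Fin e → ℕ) :
    altProd u y (List.ofFn w) = ∑ φ : Fin e → Fin d with u ∘ φ = w ∧ Function.Surjective φ,
      (-1 : ℤ) ^ d • (List.ofFn (y ∘ φ)).prod := by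
  have hexp : ∀ T : Finset (Fin d),
      ((List.ofFn w).map fun i => ∑ j ∈ T with u j = i, y j).prod =
        ∑ φ : Fin e → Fin d with u ∘ φ = w ∧ univ.image φ ⊆ T, (List.ofFn (y ∘ φ)).prod := by
    intro T
    have h := (MultilinearMap.mkPiAlgebraFin ℤ e B).map_sum_finset (fun _ j => y j)
      (fun t => T.filter fun j => u j = w t)
    simp only [MultilinearMap.mkPiAlgebraFin_apply] at h
    rw [List.map_ofFn]
    refine h.trans (Finset.sum_congr ?_ fun _ _ => rfl)
    ext φ
    simp only [Fintype.mem_piFinset, Finset.mem_filter, Finset.mem_univ, true_and,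
      Finset.image_subset_iff, forall_true_left, funext_iff, Function.comp_apply]
    exact ⟨fun h => ⟨fun t => (h t).2, fun t => (h t).1⟩, fun h t => ⟨h.2 t, h.1 t⟩⟩
  unfold altProd
  simp only [hexp, Finset.smul_sum]
  rw [Finset.sum_comm' (t' := univ.filter fun φ : Fin e → Fin d => u ∘ φ = w)
    (s' := fun φ => univ.filter fun T : Finset (Fin d) => univ.image φ ⊆ T) (by simp [and_comm])]
  rw [← Finset.filter_filter, Finset.sum_filter (p := fun φ => Function.Surjective φ)]
  refine Finset.sum_congr rfl fun φ _ => ?_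
  rw [← Finset.sum_smul, sum_superset_neg_one_pow_card, Fintype.card_fin]
  have : univ.image φ = univ ↔ Function.Surjective φ := by
    rw [← Finset.coe_eq_univ, Finset.coe_image, Finset.coe_univ, Set.image_univ,
      Set.range_eq_univ]
  simp only [this]
  split_ifs <;> simp

theorem altProd_eq_zero {d : ℕ} (u : Fin d → ℕ) (y : Fin d → B) (v : List ℕ) (hv : v.length < d) :
    altProd u y v = 0 := by
  classical
  rw [← List.ofFn_get v, altProd_ofFn]
  apply Finset.sum_eq_zero
  intro φ hφ
  have := Fintype.card_le_of_surjective φ (Finset.mem_filter.1 hφ).2.2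
  rw [Fintype.card_fin, Fintype.card_fin] at this
  omega

theorem altProd_of_length_eq {d : ℕ} (u : Fin d → ℕ) (y : Fin d → B) (v : List ℕ)
    (hv : v.length = d) :
    altProd u y v = (-1 : ℤ) ^ d • ∑ σ : Equiv.Perm (Fin d),
      if List.ofFn (u ∘ σ) = v then (List.ofFn (y ∘ σ)).prod else 0 := by
  classical
  obtain ⟨w, rfl⟩ : ∃ w : Fin d → ℕ, List.ofFn w = v := by
    subst hv; exact ⟨_, List.ofFn_get v⟩
  rw [altProd_ofFn, ← Finset.smul_sum, ← Finset.sum_filter]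
  congr 1
  symm
  refine Finset.sum_bij (fun σ _ => ⇑σ) ?_ ?_ ?_ ?_
  · intro σ hσ
    simp only [Finset.mem_filter, Finset.mem_univ, true_and] at hσ ⊢
    exact ⟨List.ofFn_injective hσ, σ.surjective⟩
  · intro σ _ τ _ h
    exact DFunLike.coe_injective h
  · intro φ hφ
    simp only [Finset.mem_filter, Finset.mem_univ, true_and] at hφ
    refine ⟨Equiv.ofBijective φ (Finite.injective_iff_bijective.1
      (Finite.injective_iff_surjective.2 hφ.2)), ?_, rfl⟩
    simp only [Finset.mem_filter, Finset.mem_univ, true_and, Equiv.coe_ofBijective]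
    rw [hφ.1]
  · intro σ _
    rfl

variable {K : Type*} [CommRing K] [Algebra K B]

theorem NCPoly.eval_eq_sum (x : ℕ → B) (f : NCPoly K) :
    f.eval x = ∑ v ∈ f.coeff.support, f.coeff v • (v.toList.map x).prod := by
  simp only [NCPoly.eval, MonoidAlgebra.lift_apply, Finsupp.sum, FreeMonoid.lift_apply]

theorem list_prod_mem_of_ne_nil {S : Submodule K B} (hmul : ∀ x ∈ S, ∀ y ∈ S, x * y ∈ S)
    (L : List B) (hL : L ≠ []) (h : ∀ x ∈ L, x ∈ S) : L.prod ∈ S := by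
  induction L with
  | nil => exact absurd rfl hL
  | cons a L ih =>
    rw [List.prod_cons]
    by_cases hL' : L = []
    · subst hL'; simpa using h a
    · exact hmul _ (h a (by simp)) _ (ih hL' fun x hx => h x (by simp [hx]))

theorem altProd_mem {S : Submodule K B} (hmul : ∀ x ∈ S, ∀ y ∈ S, x * y ∈ S) {d : ℕ}
    (u : Fin d → ℕ) (y : Fin d → B) (hy : ∀ j, y j ∈ S) (v : List ℕ) (hv : v ≠ []) :
    altProd u y v ∈ S := by
  refine Submodule.sum_mem _ fun T _ => zsmul_mem ?_ _
  refine list_prod_mem_of_ne_nil hmul _ (by simpa using hv) ?_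
  intro x hx
  obtain ⟨i, -, rfl⟩ := List.mem_map.1 hx
  exact Submodule.sum_mem _ fun j _ => hy j

/-- The linearization of an identity that vanishes on `S`, up to terms of higher degree. -/
theorem exists_linearization {S : Submodule K B} (hmul : ∀ x ∈ S, ∀ y ∈ S, x * y ∈ S)
    {f : NCPoly K} (hf : ∀ x : ℕ → B, (∀ i, x i ∈ S) → f.eval x = 0) {d : ℕ} (u : Fin d → ℕ)
    (y : Fin d → B) (hy : ∀ j, y j ∈ S) :
    ∃ P : FreeMonoid ℕ → B, (∀ v, d < v.length → P v ∈ S) ∧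
      (∑ σ : Equiv.Perm (Fin d), f.coeff (FreeMonoid.ofList (List.ofFn (u ∘ σ))) •
        (List.ofFn (y ∘ σ)).prod) +
      ∑ v ∈ f.coeff.support with d < v.length, f.coeff v • P v = 0 := by
  classical
  refine ⟨fun v => (-1 : ℤ) ^ d • altProd u y v.toList, fun v hv => ?_, ?_⟩
  · refine zsmul_mem (altProd_mem hmul u y hy _ ?_) _
    intro h
    have : v.length = 0 := by rw [FreeMonoid.length, h]; rfl
    omega
  have hzero : ∑ v ∈ f.coeff.support, f.coeff v • altProd u y v.toList = 0 := by
    have h : ∑ T : Finset (Fin d), (-1 : ℤ) ^ T.card •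
        f.eval (fun i => ∑ j ∈ T with u j = i, y j) = 0 := by
      refine Finset.sum_eq_zero fun T _ => ?_
      rw [hf _ fun i => Submodule.sum_mem _ fun j _ => hy j, smul_zero]
    simp only [NCPoly.eval_eq_sum, Finset.smul_sum] at h
    rw [Finset.sum_comm] at h
    rw [← h]
    refine Finset.sum_congr rfl fun v _ => ?_
    rw [altProd, Finset.smul_sum]
    exact Finset.sum_congr rfl fun T _ => smul_comm _ _ _
  have hsq : ∀ b : B, (-1 : ℤ) ^ d • (-1 : ℤ) ^ d • b = b := fun b => by
    rw [smul_smul, ← mul_pow]; simp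
  have hsplit := Finset.sum_filter_add_sum_filter_not f.coeff.support
    (fun v => d < v.length) (fun v => f.coeff v • (-1 : ℤ) ^ d • altProd u y v.toList)
  have hall : ∑ v ∈ f.coeff.support, f.coeff v • (-1 : ℤ) ^ d • altProd u y v.toList = 0 := by
    simp only [smul_comm (f.coeff _) ((-1 : ℤ) ^ d)]
    rw [← Finset.smul_sum, hzero, smul_zero]
  rw [hall] at hsplit
  rw [← hsplit, add_comm]
  congr 1
  -- No surjection exists in degree below `d`; in degree `d` the surjections are permutations.
  have hlow : ∀ v ∈ f.coeff.support.filter (fun v => ¬ d < v.length),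
      f.coeff v • (-1 : ℤ) ^ d • altProd u y v.toList =
      ∑ σ : Equiv.Perm (Fin d), if FreeMonoid.ofList (List.ofFn (u ∘ σ)) = v then
        f.coeff v • (List.ofFn (y ∘ σ)).prod else 0 := by
    intro v hv
    simp only [Finset.mem_filter, not_lt] at hv
    rcases hv.2.eq_or_lt with h | h
    · rw [altProd_of_length_eq u y v.toList h, hsq, Finset.smul_sum]
      refine Finset.sum_congr rfl fun σ _ => ?_
      rw [smul_ite, smul_zero]
      exact if_congr Iff.rfl rfl rfl
    · rw [altProd_eq_zero u y v.toList h, smul_zero, smul_zero]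
      symm
      refine Finset.sum_eq_zero fun σ _ => if_neg ?_
      rintro rfl
      rw [FreeMonoid.length] at h
      simp at h
  rw [Finset.sum_congr rfl hlow, Finset.sum_comm]
  refine Finset.sum_congr rfl fun σ _ => ?_
  rw [Finset.sum_ite_eq]
  split_ifs with h
  · rfl
  · simp only [Finset.mem_filter, Finsupp.mem_support_iff, not_and_or, not_not] at h
    rcases h with h | h
    · rw [h, zero_smul]
    · rw [FreeMonoid.length] at h
      simp at h

end Linearization

/-! ### Permuting the factors of a division. -/

section Division

variable {α : Type*} [LinearOrder α]

/-- Factors must evaluate into a possibly non-unital algebra. Comparable words are nonempty, which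
settles all `d` except `d = 1`, where the whole word is taken as the only factor. -/
theorem ListNDivisible.exists_ofFn {d : ℕ} {W : List α} (h : ListNDivisible d W) :
    ∃ (v : List α) (w : Fin d → List α), (∀ i j, i < j → ListGT (w i) (w j)) ∧
      W = v ++ (List.ofFn w).flatten ∧ ∀ i, w i ≠ [] ∨ w i = W := by
  obtain ⟨v, us, rfl, h2, h3⟩ := h
  by_cases h1 : us.length = 1
  · refine ⟨[], fun _ => W, fun i j hij => by omega, ?_, fun i => Or.inr rfl⟩
    rw [h1]; simp
  · rw [List.pairwise_iff_get] at h2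
    refine ⟨v, us.get, h2, by rw [List.ofFn_get, h3], fun i => Or.inl fun hi => ?_⟩
    obtain ⟨j, hj⟩ : ∃ j : Fin us.length, j ≠ i := by
      have := i.2
      by_cases h0 : i.1 = 0
      · exact ⟨⟨1, by omega⟩, by rw [Ne, Fin.ext_iff]; simp [h0]⟩
      · exact ⟨⟨0, by omega⟩, by rw [Ne, Fin.ext_iff]; simp; omega⟩
    rcases lt_or_gt_of_ne hj with hlt | hlt
    · have := h2 j i hlt
      rw [hi] at this
      exact not_listGT_nil_right _ this
    · have := h2 i j hlt
      rw [hi] at this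
      exact not_listGT_nil_left _ this

/-- At the first index moved by `σ`, the factor is replaced by a later, hence smaller, one;
everything before is unchanged. -/
theorem listGT_flatten_perm {d : ℕ} {w : Fin d → List α} (hw : ∀ i j, i < j → ListGT (w i) (w j))
    {σ : Equiv.Perm (Fin d)} (hσ : σ ≠ 1) :
    ListGT (List.ofFn w).flatten (List.ofFn (w ∘ σ)).flatten := by
  have hex : ∃ i, ∃ h : i < d, σ ⟨i, h⟩ ≠ ⟨i, h⟩ := by
    by_contra hcon
    apply hσ
    ext i
    by_contra hi
    exact hcon ⟨i, i.2, fun h => hi (by simp [h])⟩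
  classical
  set i := Nat.find hex with hi
  obtain ⟨hid, hne⟩ : ∃ h : i < d, σ ⟨i, h⟩ ≠ ⟨i, h⟩ := Nat.find_spec hex
  have hmin : ∀ j : Fin d, j.1 < i → σ j = j := by
    intro j hj
    by_contra h
    exact Nat.find_min hex hj ⟨j.2, h⟩
  have hgt : (⟨i, hid⟩ : Fin d) < σ ⟨i, hid⟩ := by
    rcases lt_trichotomy (⟨i, hid⟩ : Fin d) (σ ⟨i, hid⟩) with h | h | h
    · exact h
    · exact absurd h.symm hne
    · have h' := hmin _ h
      exact absurd (σ.injective h') hne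
  have hsplit : ∀ A : List (List α), ∀ hA : i < A.length, A.flatten =
      (A.take i).flatten ++ (A[i] ++ (A.drop (i + 1)).flatten) := by
    intro A hA
    rw [← List.flatten_cons, ← List.drop_eq_getElem_cons hA, ← List.flatten_append,
      List.take_append_drop]
  have htake : (List.ofFn w).take i = (List.ofFn (w ∘ σ)).take i := by
    apply List.ext_getElem (by simp)
    intro j hj _
    simp only [List.length_take, List.length_ofFn, lt_inf_iff] at hj
    simp [hmin ⟨j, hj.2⟩ hj.1]
  rw [hsplit (List.ofFn w) (by simpa using hid), hsplit (List.ofFn (w ∘ σ)) (by simpa using hid),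
    htake]
  apply ListGT.append_left
  apply ListGT.append_right
  simpa using hw _ _ hgt

end Division

/-! ### Rewriting words by the identity. -/

section Spanning

variable {K B : Type*} [CommRing K] [Ring B] [Algebra K B] {l : ℕ}

theorem lift_mul_mem {S : Submodule K B} (hmul : ∀ x ∈ S, ∀ y ∈ S, x * y ∈ S) {a : Fin l → B}
    (ha : ∀ i, a i ∈ S) (W : FreeMonoid (Fin l)) {s : B} (hs : s ∈ S) :
    FreeMonoid.lift a W * s ∈ S := by
  induction W using FreeMonoid.recOn with
  | one => simpa using hs
  | of_mul x xs ih =>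
    rw [map_mul, mul_assoc, FreeMonoid.lift_eval_of]
    exact hmul _ (ha x) _ ih

theorem lift_mem_of_ne_one {S : Submodule K B} (hmul : ∀ x ∈ S, ∀ y ∈ S, x * y ∈ S)
    {a : Fin l → B} (ha : ∀ i, a i ∈ S) (W : FreeMonoid (Fin l)) (hW : W ≠ 1) :
    FreeMonoid.lift a W ∈ S := by
  rw [FreeMonoid.lift_apply]
  refine list_prod_mem_of_ne_nil hmul _ ?_ ?_
  · intro h
    exact hW (FreeMonoid.toList.injective (by simpa using h))
  · intro x hx
    obtain ⟨i, -, rfl⟩ := List.mem_map.1 hx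
    exact ha i

/-- If the coefficients of degree greater than `d` carry `S` into `V`, then those of degree `d`
carry the words of length `k` into `V`, provided that `V` contains those of these words that are
not `d`-divisible. -/
theorem coeff_smul_word_mem {S V : Submodule K B} (hmul : ∀ x ∈ S, ∀ y ∈ S, x * y ∈ S)
    {f : NCPoly K} (hf : ∀ x : ℕ → B, (∀ i, x i ∈ S) → f.eval x = 0) {a : Fin l → B}
    (ha : ∀ i, a i ∈ S) {d k : ℕ}
    (hk : ∀ W : FreeMonoid (Fin l), W.length = k → FreeMonoid.lift a W ∈ S)
    (hV : ∀ W : FreeMonoid (Fin l), W.length = k → ¬ NDivisible d W → FreeMonoid.lift a W ∈ V)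
    (hhigh : ∀ v : FreeMonoid ℕ, d < v.length → ∀ s ∈ S, f.coeff v • s ∈ V)
    (W : FreeMonoid (Fin l)) (hW : W.length = k) (u : FreeMonoid ℕ) (hu : u.length = d) :
    f.coeff u • FreeMonoid.lift a W ∈ V := by
  -- Words of one length over a finite alphabet are finitely many, so induction along the
  -- lexicographic order is legitimate. All coefficients of degree `d` are treated at once, since
  -- permuting factors changes the coefficient.
  have : Finite {W : List (Fin l) // W.length = k} := (List.finite_length_eq (Fin l) k).to_subtype
  suffices h : ∀ W : {W : List (Fin l) // W.length = k}, ∀ u : FreeMonoid ℕ, u.length = d →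
      f.coeff u • FreeMonoid.lift a (FreeMonoid.ofList W.1) ∈ V from h ⟨W.toList, hW⟩ u hu
  clear hW hu W u
  intro W
  induction W using WellFoundedLT.induction with
  | _ W ih =>
    obtain ⟨W, hWk⟩ := W
    intro u hu
    by_cases hdiv : NDivisible d (FreeMonoid.ofList W)
    swap
    · exact V.smul_mem _ (hV _ hWk hdiv)
    obtain ⟨v, w, hw, hWv, hne⟩ := (nDivisible_ofList_iff.1 hdiv).exists_ofFn
    have hy : ∀ i, FreeMonoid.lift a (FreeMonoid.ofList (w i)) ∈ S := by
      intro i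
      rcases hne i with h | h
      · exact lift_mem_of_ne_one hmul ha _ fun h' => h (congrArg FreeMonoid.toList h')
      · rw [h]; exact hk _ hWk
    obtain ⟨u, rfl⟩ : ∃ u' : Fin d → ℕ, FreeMonoid.ofList (List.ofFn u') = u := by
      subst hu
      exact ⟨u.toList.get, congrArg FreeMonoid.ofList (List.ofFn_get u.toList)⟩
    obtain ⟨P, hP, hlin⟩ := exists_linearization hmul hf u
      (fun i => FreeMonoid.lift a (FreeMonoid.ofList (w i))) hy
    have hword : ∀ σ : Equiv.Perm (Fin d),
        FreeMonoid.lift a (FreeMonoid.ofList v) * (List.ofFn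
          ((fun i => FreeMonoid.lift a (FreeMonoid.ofList (w i))) ∘ σ)).prod =
        FreeMonoid.lift a (FreeMonoid.ofList (v ++ (List.ofFn (w ∘ σ)).flatten)) := by
      intro σ
      rw [FreeMonoid.ofList_append, map_mul]
      congr 1
      rw [FreeMonoid.ofList_flatten, map_list_prod, List.map_ofFn, List.map_ofFn]
      rfl
    have hlin' := congrArg (FreeMonoid.lift a (FreeMonoid.ofList v) * ·) hlin
    simp only [mul_add, Finset.mul_sum, mul_smul_comm, mul_zero] at hlin'
    rw [← Finset.add_sum_erase _ _ (Finset.mem_univ (1 : Equiv.Perm (Fin d))),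
      add_assoc] at hlin'
    simp only [hword] at hlin'
    rw [Equiv.Perm.coe_one, Function.comp_id, Function.comp_id, ← hWv] at hlin'
    rw [eq_neg_of_add_eq_zero_left hlin']
    refine V.neg_mem (V.add_mem ?_ ?_)
    · refine V.sum_mem fun σ hσ => ?_
      have hlt := (listGT_flatten_perm hw (Finset.ne_of_mem_erase hσ)).append_left v
      rw [← hWv] at hlt
      have hlen : (v ++ (List.ofFn (w ∘ σ)).flatten).length = k := by
        rw [← hWk, hWv, List.length_append, List.length_append, List.length_flatten,
          List.length_flatten, List.map_ofFn, List.map_ofFn, List.sum_ofFn, List.sum_ofFn]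
        congr 1
        exact Equiv.sum_comp σ fun i => (w i).length
      exact ih ⟨_, hlen⟩ hlt.lt _ (by rw [FreeMonoid.length]; simp)
    · refine V.sum_mem fun x hx => ?_
      have hx := (Finset.mem_filter.1 hx).2
      exact hhigh x hx _ (lift_mul_mem hmul ha _ (hP x hx))

/-- An algebra that satisfies an admissible identity of degree at most `n` is spanned by the words
that are not `n`-divisible. -/
theorem le_span_not_nDivisible {S : Submodule K B} (hmul : ∀ x ∈ S, ∀ y ∈ S, x * y ∈ S)
    {f : NCPoly K} (hf : ∀ x : ℕ → B, (∀ i, x i ∈ S) → f.eval x = 0) {a : Fin l → B}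
    (ha : ∀ i, a i ∈ S) (k₀ : ℕ)
    (hS : S = Submodule.span K (FreeMonoid.lift a '' {W | k₀ ≤ W.length}))
    (hadm : f.Admissible) {n : ℕ} (hn : f.degree ≤ n) :
    S ≤ Submodule.span K (FreeMonoid.lift a '' {W | ¬ NDivisible n W}) := by
  set V := Submodule.span K (FreeMonoid.lift a '' {W : FreeMonoid (Fin l) | ¬ NDivisible n W})
    with hV
  -- Descending induction on the degree of the monomial, starting above the degree of `f`. The
  -- coefficient `1` may thus stand in any degree, not only the top one.
  have key : ∀ j, ∀ v : FreeMonoid ℕ, n < v.length + j → ∀ s ∈ S, f.coeff v • s ∈ V := by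
    intro j
    induction j with
    | zero =>
      intro v hv s _
      have : f.coeff v = 0 := by
        by_contra h
        have := Finset.le_sup (f := FreeMonoid.length) (Finsupp.mem_support_iff.2 h)
        rw [NCPoly.degree] at hn
        omega
      rw [this, zero_smul]
      exact V.zero_mem
    | succ j ih =>
      intro v hv s hs
      by_cases hvn : n < v.length
      · exact ih v (by omega) s hs
      rw [hS] at hs
      refine Submodule.span_induction (p := fun s _ => f.coeff v • s ∈ V) ?_ ?_ ?_ ?_ hs
      · rintro _ ⟨W, hW, rfl⟩
        refine coeff_smul_word_mem hmul hf ha (k := W.length) (d := v.length) ?_ ?_ ?_ W rfl v rfl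
        · intro W' hW'
          rw [hS]
          refine Submodule.subset_span ⟨W', ?_, rfl⟩
          rw [Set.mem_ofPred_eq, hW']
          exact hW
        · intro W' _ hdiv
          refine Submodule.subset_span ⟨W', fun h => hdiv ?_, rfl⟩
          exact nDivisible_ofList_iff.2
            (listNDivisible_mono (W := W'.toList) (by omega) (nDivisible_ofList_iff.1 h))
        · intro x hx
          exact ih x (by omega)
      · rw [smul_zero]; exact V.zero_mem
      · intro x y _ _ hx hy
        rw [smul_add]; exact V.add_mem hx hy
      · intro c x _ hx
        rw [smul_comm]; exact V.smul_mem _ hx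
  obtain ⟨w, hw⟩ := hadm
  intro s hs
  have := key (n + 1) w (by omega) s hs
  rwa [hw, one_smul] at this

theorem image_powProducts_subset {M N : Type*} [Monoid M] [Monoid N] (φ : M →* N) (Y : Set M)
    (h : ℕ) : φ '' powProducts Y h ⊆ powProducts (φ '' Y) h := by
  rintro _ ⟨x, ⟨L, h1, h2, rfl⟩, rfl⟩
  refine ⟨L.map fun p => (φ p.1, p.2), by simpa using h1, ?_, ?_⟩
  · intro p hp
    obtain ⟨q, hq, rfl⟩ := List.mem_map.1 hp
    exact ⟨q.1, h2 q hq, rfl⟩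
  · rw [map_list_prod, List.map_map, List.map_map]
    simp [Function.comp_def]

theorem exists_isSpanHeight {S : Submodule K B} (hmul : ∀ x ∈ S, ∀ y ∈ S, x * y ∈ S)
    {f : NCPoly K} (hf : ∀ x : ℕ → B, (∀ i, x i ∈ S) → f.eval x = 0) {a : Fin l → B}
    (ha : ∀ i, a i ∈ S) (k₀ : ℕ)
    (hS : S = Submodule.span K (FreeMonoid.lift a '' {W | k₀ ≤ W.length}))
    (hadm : f.Admissible) {n : ℕ} (hn : 2 ≤ n) (hdeg : f.degree ≤ n) :
    ∃ h : ℕ, IsSpanHeight K S (FreeMonoid.lift a '' shortWords (Fin l) n) h ∧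
      (h : ℝ) ≤ Phi n l := by
  obtain ⟨k, hk, hkP⟩ := exists_height_bound hn l
  have hle : S ≤ Submodule.span K (powProducts (FreeMonoid.lift a '' shortWords (Fin l) n) k) :=
    (le_span_not_nDivisible hmul hf ha k₀ hS hadm hdeg).trans
      (Submodule.span_mono ((Set.image_mono hk).trans (image_powProducts_subset _ _ _)))
  obtain ⟨h, h1, h2⟩ := exists_isLeast_le
    (P := fun k => S ≤ Submodule.span K (powProducts (FreeMonoid.lift a '' shortWords (Fin l) n) k))
    hle
  exact ⟨h, h1, le_trans (by exact_mod_cast h2) hkP⟩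

end Spanning

end Shirshov

namespace Shirshov

/-! ### Algebras as spans of words in their generators. -/

section Generation

variable {K : Type*} [CommRing K] {l : ℕ}

theorem mul_mem_span_words {B : Type*} [Ring B] [Algebra K B] (a : Fin l → B) (j k : ℕ) {x y : B}
    (hx : x ∈ Submodule.span K (FreeMonoid.lift a '' {W | j ≤ W.length}))
    (hy : y ∈ Submodule.span K (FreeMonoid.lift a '' {W | k ≤ W.length})) :
    x * y ∈ Submodule.span K (FreeMonoid.lift a '' {W | j + k ≤ W.length}) := by
  have h := Submodule.mul_mem_mul hx hy
  rw [Submodule.span_mul_span] at h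
  refine Submodule.span_mono ?_ h
  rintro _ ⟨_, ⟨W, hW, rfl⟩, _, ⟨W', hW', rfl⟩, rfl⟩
  refine ⟨W * W', ?_, map_mul _ _ _⟩
  rw [Set.mem_ofPred_eq] at *
  rw [FreeMonoid.length_mul]; omega

theorem top_eq_span_words {A : Type*} [Ring A] [Algebra K A] {a : Fin l → A}
    (ha : Algebra.adjoin K (Set.range a) = ⊤) :
    (⊤ : Submodule K A) = Submodule.span K (FreeMonoid.lift a '' {W | 0 ≤ W.length}) := by
  symm
  rw [eq_top_iff]
  intro x _
  have hx : x ∈ Algebra.adjoin K (Set.range a) := by rw [ha]; trivial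
  induction hx using Algebra.adjoin_induction with
  | mem x hx =>
    obtain ⟨i, rfl⟩ := hx
    exact Submodule.subset_span ⟨FreeMonoid.of i, Nat.zero_le _, by simp⟩
  | algebraMap r =>
    rw [Algebra.algebraMap_eq_smul_one]
    exact Submodule.smul_mem _ _ (Submodule.subset_span ⟨1, Nat.zero_le _, map_one _⟩)
  | add x y _ _ hx hy => exact Submodule.add_mem _ (hx trivial) (hy trivial)
  | mul x y _ _ hx hy => exact mul_mem_span_words a 0 0 (hx trivial) (hy trivial)

theorem inr_mem_range {A : Type*} [NonUnitalRing A] [Module K A] (x : A) :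
    (x : Unitization K A) ∈ LinearMap.range (Unitization.inrHom K K A) := ⟨x, rfl⟩

theorem mul_mem_range_inr {A : Type*} [NonUnitalRing A] [Module K A] :
    ∀ x ∈ LinearMap.range (Unitization.inrHom K K A),
    ∀ y ∈ LinearMap.range (Unitization.inrHom K K A),
      x * y ∈ LinearMap.range (Unitization.inrHom K K A) := by
  rintro _ ⟨x, rfl⟩ _ ⟨y, rfl⟩
  exact ⟨x * y, Unitization.inr_mul K x y⟩

variable {A : Type*} [NonUnitalRing A] [Module K A] [IsScalarTower K A A] [SMulCommClass K A A]

theorem range_inr_eq_span_words {a : Fin l → A}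
    (ha : NonUnitalAlgebra.adjoin K (Set.range a) = ⊤) :
    LinearMap.range (Unitization.inrHom K K A) = Submodule.span K
      (FreeMonoid.lift (fun i => (a i : Unitization K A)) '' {W | 1 ≤ W.length}) := by
  apply le_antisymm
  · rintro _ ⟨x, rfl⟩
    rw [Unitization.inrHom_apply]
    have hx : x ∈ NonUnitalAlgebra.adjoin K (Set.range a) := by rw [ha]; trivial
    induction hx using NonUnitalAlgebra.adjoin_induction with
    | mem x hx =>
      obtain ⟨i, rfl⟩ := hx
      exact Submodule.subset_span ⟨FreeMonoid.of i, Nat.le_refl 1, by simp⟩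
    | add x y _ _ hx hy =>
      rw [Unitization.inr_add]; exact Submodule.add_mem _ hx hy
    | zero => rw [Unitization.inr_zero]; exact Submodule.zero_mem _
    | mul x y _ _ hx hy =>
      rw [Unitization.inr_mul]
      refine Submodule.span_mono (Set.image_mono ?_) (mul_mem_span_words _ 1 1 hx hy)
      intro W hW
      rw [Set.mem_ofPred_eq] at *
      omega
    | smul r x _ hx => rw [Unitization.inr_smul]; exact Submodule.smul_mem _ _ hx
  · rw [Submodule.span_le]
    rintro _ ⟨W, hW, rfl⟩
    refine lift_mem_of_ne_one mul_mem_range_inr (fun i => inr_mem_range (a i)) W ?_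
    rintro rfl
    simp at hW

theorem eval_eq_zero_of_isIdentity {f : NCPoly K} (hf : IsIdentity A f) (x : ℕ → Unitization K A)
    (hx : ∀ i, x i ∈ LinearMap.range (Unitization.inrHom K K A)) : f.eval x = 0 := by
  choose y hy using hx
  have : x = fun i => (y i : Unitization K A) := funext fun i => (hy i).symm
  rw [this]
  exact hf y

end Generation

/-! ### Nil rings and the nilpotency class. -/

section Nil

variable {l : ℕ}

theorem length_pow (W : FreeMonoid (Fin l)) (k : ℕ) : (W ^ k).length = k * W.length := by
  induction k with
  | zero => simp
  | succ k ih => rw [pow_succ, FreeMonoid.length_mul, ih]; ring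

/-- If all nontrivial bases, of length less than `m`, have exponents less than `m`, then each block
has length at most `m ^ 2`. A longer word thus contains an `m`-th power. -/
theorem lift_powProduct_eq_zero {m : ℕ} {B : Type*} [Ring B] {φ : FreeMonoid (Fin l) →* B}
    (hnil : ∀ W, W ≠ 1 → φ W ^ m = 0) {k : ℕ} {W : FreeMonoid (Fin l)}
    (hW : W ∈ powProducts (shortWords (Fin l) m) k) (hlen : k * m ^ 2 < W.length) : φ W = 0 := by
  obtain ⟨L, hLk, hL, rfl⟩ := hW
  have key : ∀ L : List (FreeMonoid (Fin l) × ℕ), (∀ p ∈ L, p.1 ∈ shortWords (Fin l) m) →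
      φ (L.map fun p : FreeMonoid (Fin l) × ℕ => p.1 ^ p.2).prod = 0 ∨
        ((L.map fun p : FreeMonoid (Fin l) × ℕ => p.1 ^ p.2).prod).length ≤ L.length * m ^ 2 := by
    intro L hL
    induction L with
    | nil => right; simp
    | cons p L ih =>
      have hp : p.1.length < m := hL p (by simp)
      rw [List.map_cons, List.prod_cons, map_mul, FreeMonoid.length_mul, length_pow,
        List.length_cons]
      rcases ih fun q hq => hL q (by simp [hq]) with h | h
      · left; rw [h, mul_zero]
      by_cases hp1 : p.1 = 1
      · right; rw [hp1, FreeMonoid.length_one]; nlinarith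
      by_cases hpm : m ≤ p.2
      · left
        rw [map_pow, ← Nat.sub_add_cancel hpm, pow_add, hnil _ hp1, mul_zero, zero_mul]
      · right
        have : p.2 * p.1.length ≤ m * m := Nat.mul_le_mul (by omega) hp.le
        nlinarith
  refine (key L hL).resolve_right fun h => ?_
  have := Nat.mul_le_mul_right (m ^ 2) hLk
  omega

/-- The polynomial `x ^ m`. -/
noncomputable def powPoly (K : Type*) [CommRing K] (m : ℕ) : NCPoly K :=
  MonoidAlgebra.single (FreeMonoid.of 0 ^ m) 1

theorem powPoly_eval {K B : Type*} [CommRing K] [Ring B] [Algebra K B] (m : ℕ) (x : ℕ → B) :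
    (powPoly K m).eval x = x 0 ^ m := by
  rw [NCPoly.eval, powPoly, MonoidAlgebra.lift_single, one_smul, map_pow, FreeMonoid.lift_eval_of]

theorem length_of_zero_pow (m : ℕ) : (FreeMonoid.of (0 : ℕ) ^ m).length = m := by
  induction m with
  | zero => rfl
  | succ m ih => rw [pow_succ, FreeMonoid.length_mul, ih, FreeMonoid.length_of]

theorem prod_eq_zero_of_nil {K R : Type*} [CommRing K] [NonUnitalRing R] [Module K R]
    [IsScalarTower K R R] [SMulCommClass K R R] {m k : ℕ} {a : Fin l → R}
    (ha : NonUnitalAlgebra.adjoin K (Set.range a) = ⊤)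
    (hnil : ∀ x : R, (x : Unitization K R) ^ m = 0)
    (hk : {W : FreeMonoid (Fin l) | ¬ NDivisible m W} ⊆ powProducts (shortWords (Fin l) m) k)
    (x : Fin (k * m ^ 2 + 1) → R) :
    (List.ofFn fun i => (x i : Unitization K R)).prod = 0 := by
  set φ := FreeMonoid.lift fun i => (a i : Unitization K R) with hφ
  have hmem : ∀ W, W ≠ 1 → φ W ∈ LinearMap.range (Unitization.inrHom K K R) := fun W hW =>
    lift_mem_of_ne_one mul_mem_range_inr (fun i => inr_mem_range (a i)) W hW
  have hnilW : ∀ W, W ≠ 1 → φ W ^ m = 0 := by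
    intro W hW
    obtain ⟨x, hx⟩ := hmem W hW
    rw [← hx]
    exact hnil x
  have hne : ∀ W : FreeMonoid (Fin l), k * m ^ 2 + 1 ≤ W.length → W ≠ 1 := by
    rintro _ hW rfl
    simp at hW
  have hzero : ∀ W : FreeMonoid (Fin l), k * m ^ 2 + 1 ≤ W.length → φ W = 0 := by
    intro W hW
    -- With `V = ⊥` the rewriting shows vanishing: `x ^ m` has no terms of higher degree, and long
    -- words that are not `m`-divisible are already zero.
    have h := coeff_smul_word_mem (V := ⊥) (f := powPoly K m) (d := m) (k := W.length)
      (a := fun i => (a i : Unitization K R)) mul_mem_range_inr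
      (fun x hx => by
        obtain ⟨y, hy⟩ := hx 0
        rw [powPoly_eval, ← hy]
        exact hnil y)
      (fun i => inr_mem_range (a i))
      (fun W' hW' => hmem W' (hne W' (by omega)))
      (fun W' hW' hdiv => by
        rw [Submodule.mem_bot]
        exact lift_powProduct_eq_zero hnilW (hk hdiv) (by omega))
      (fun v hv s _ => by
        have : (powPoly K m).coeff v = 0 := by
          rw [powPoly, MonoidAlgebra.coeff_single]
          refine Finsupp.single_eq_of_ne ?_
          rintro rfl
          rw [length_of_zero_pow] at hv
          omega
        rw [this, zero_smul]
        exact Submodule.zero_mem _)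
      W rfl (FreeMonoid.of 0 ^ m) (length_of_zero_pow m)
    rw [powPoly, MonoidAlgebra.coeff_single, Finsupp.single_eq_same, one_smul] at h
    exact (Submodule.mem_bot K).1 h
  have hprod : ∀ L : List R, (L.map fun x : R => (x : Unitization K R)).prod ∈
      Submodule.span K (φ '' {W | L.length ≤ W.length}) := by
    intro L
    induction L with
    | nil => exact Submodule.subset_span ⟨1, Nat.zero_le _, by simp⟩
    | cons x L ih =>
      rw [List.map_cons, List.prod_cons, List.length_cons, add_comm]
      refine mul_mem_span_words _ 1 _ ?_ ih
      rw [← range_inr_eq_span_words ha]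
      exact inr_mem_range x
  have h := hprod (List.ofFn x)
  rw [List.map_ofFn, List.length_ofFn] at h
  have hle : Submodule.span K (φ '' {W | k * m ^ 2 + 1 ≤ W.length}) ≤ ⊥ := by
    rw [Submodule.span_le]
    rintro _ ⟨W, hW, rfl⟩
    exact hzero W hW
  exact (Submodule.mem_bot K).1 (hle h)

theorem exists_isNilpotencyClass {R : Type*} [NonUnitalRing R] {m : ℕ} (hm : 2 ≤ m) {a : Fin l → R}
    (ha : NonUnitalAlgebra.adjoin ℤ (Set.range a) = ⊤)
    (hnil : ∀ x : R, (x : Unitization ℤ R) ^ m = 0) :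
    ∃ N : ℕ, IsNilpotencyClass R N ∧ (N : ℝ) ≤ m ^ 2 * Phi m l + 1 := by
  obtain ⟨k, hk, hkP⟩ := exists_height_bound hm l
  obtain ⟨N, hN, hNk⟩ := exists_isLeast_le (k := k * m ^ 2 + 1) (P := fun k => ∀ x : Fin k → R,
    (List.ofFn fun i => (x i : Unitization ℤ R)).prod = 0) (prod_eq_zero_of_nil ha hnil hk)
  refine ⟨N, hN, ?_⟩
  have h1 : (N : ℝ) ≤ ((k * m ^ 2 + 1 : ℕ) : ℝ) := by exact_mod_cast hNk
  push_cast at h1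
  have h2 : (k : ℝ) * (m : ℝ) ^ 2 ≤ Phi m l * (m : ℝ) ^ 2 := by gcongr
  linarith

/-- The projection of the free ring onto the free ring with the identity `x ^ m = 0`. -/
noncomputable def nilProj (l m : ℕ) : FreeNURing l →ₙ+* FreeNilRing l m where
  toFun x := (x : (nilCon l m).Quotient)
  map_mul' _ _ := rfl
  map_zero' := rfl
  map_add' _ _ := rfl

theorem nilProj_surjective (l m : ℕ) : Function.Surjective (nilProj l m) :=
  Quotient.mk''_surjective

/-- Powers are formed in the ring with a unit adjoined; a positive power comes from an element of
the ring itself, compatibly with the projection, so the defining relations apply to it. -/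
theorem exists_inr_eq_pow (l m : ℕ) {j : ℕ} (hj : 1 ≤ j) (x : FreeNURing l) :
    ∃ y : FreeNURing l,
      (y : Unitization ℤ (FreeNURing l)) = (x : Unitization ℤ (FreeNURing l)) ^ j ∧
      (nilProj l m y : Unitization ℤ (FreeNilRing l m)) =
        (nilProj l m x : Unitization ℤ (FreeNilRing l m)) ^ j := by
  induction j, hj using Nat.le_induction with
  | base => exact ⟨x, by simp, by simp⟩
  | succ j _ ih =>
    obtain ⟨y, h1, h2⟩ := ih
    refine ⟨y * x, ?_, ?_⟩
    · rw [Unitization.inr_mul, h1, pow_succ]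
    · rw [map_mul, Unitization.inr_mul, h2, pow_succ]

theorem inr_pow_eq_zero (l : ℕ) {m : ℕ} (hm : 1 ≤ m) (x : FreeNilRing l m) :
    (x : Unitization ℤ (FreeNilRing l m)) ^ m = 0 := by
  obtain ⟨x, rfl⟩ := nilProj_surjective l m x
  obtain ⟨y, h1, h2⟩ := exists_inr_eq_pow l m hm x
  have hy : nilProj l m y = 0 := by
    have : nilCon l m y 0 := RingConGen.Rel.of _ _ ⟨rfl, x, h1⟩
    exact (RingCon.eq _).2 this
  rw [← h2, hy, Unitization.inr_zero]

theorem adjoin_range_eq_top {R : Type*} [NonUnitalRing R] {π : FreeNURing l →ₙ+* R}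
    (hπ : Function.Surjective π) :
    NonUnitalAlgebra.adjoin ℤ (Set.range fun i : Fin l =>
      π (MonoidAlgebra.single (FreeSemigroup.of i) 1)) = ⊤ := by
  rw [NonUnitalAlgebra.eq_top_iff]
  intro x
  obtain ⟨x, rfl⟩ := hπ x
  induction x using MonoidAlgebra.induction_linear with
  | zero => rw [map_zero]; exact zero_mem _
  | add x y hx hy => rw [map_add]; exact add_mem hx hy
  | single w r =>
    have : (MonoidAlgebra.single w r : FreeNURing l) = r • MonoidAlgebra.single w 1 := by simp
    rw [this, map_zsmul]
    refine zsmul_mem ?_ r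
    induction w using FreeSemigroup.recOnMul with
    | ih1 i => exact NonUnitalAlgebra.subset_adjoin ℤ ⟨i, rfl⟩
    | ih2 i y h1 h2 =>
      have : (MonoidAlgebra.single (FreeSemigroup.of i * y) 1 : FreeNURing l) =
          MonoidAlgebra.single (FreeSemigroup.of i) 1 * MonoidAlgebra.single y 1 := by
        rw [MonoidAlgebra.single_mul_single, one_mul]
      rw [this, map_mul]
      exact mul_mem (h1 (by simp)) (h2 (by simp))

open Asymptotics Filter in
theorem exists_nilpotencyClass_isLittleO (l : ℕ) : ∃ N : ℕ → ℕ,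
    (∀ m : ℕ, 1 ≤ m → IsNilpotencyClass (FreeNilRing l m) (N m)) ∧
    ∀ c : ℝ, 1 < c → (fun m : ℕ => (N m : ℝ)) =o[atTop] fun m : ℕ => c ^ m := by
  have hex : ∀ m : ℕ, ∃ N : ℕ, (1 ≤ m → IsNilpotencyClass (FreeNilRing l m) N) ∧
      (2 ≤ m → (N : ℝ) ≤ m ^ 2 * Phi m l + 1) := by
    intro m
    rcases le_or_gt 2 m with hm | hm
    · obtain ⟨N, h1, h2⟩ := exists_isNilpotencyClass hm
        (adjoin_range_eq_top (nilProj_surjective l m)) (inr_pow_eq_zero l (by omega))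
      exact ⟨N, fun _ => h1, fun _ => h2⟩
    · rcases Nat.eq_zero_or_pos m with rfl | hm0
      · exact ⟨0, fun h => by omega, fun h => by omega⟩
      -- The height bound needs `m ≥ 2`; for `m = 1` the ring is zero.
      · obtain rfl : m = 1 := by omega
        obtain ⟨N, hN, -⟩ := exists_isLeast_le (k := 1)
          (P := fun k => ∀ x : Fin k → FreeNilRing l 1,
            (List.ofFn fun i => (x i : Unitization ℤ (FreeNilRing l 1))).prod = 0) (by
            intro x
            have := inr_pow_eq_zero l le_rfl (x 0)
            rw [pow_one] at this
            simpa using this)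
        exact ⟨N, fun _ => hN, fun h => by omega⟩
  choose N hN hb using hex
  refine ⟨N, hN, fun c hc => ?_⟩
  have h1 : (fun m : ℕ => (m : ℝ) ^ 2 * Phi m l + 1) =o[atTop] fun m : ℕ => c ^ m := by
    refine (pow_mul_Phi_isLittleO 2 l hc).add ?_
    refine isLittleO_const_left.2 (Or.inr ?_)
    exact tendsto_norm_atTop_atTop.comp (tendsto_pow_atTop_atTop_of_one_lt hc)
  refine (IsBigO.of_bound 1 ?_).trans_isLittleO h1
  filter_upwards [eventually_ge_atTop 2] with m hm
  rw [Real.norm_of_nonneg (by positivity), one_mul]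
  exact (hb m hm).trans (le_abs_self _)

end Nil

end Shirshov

theorem mainTheorem1 :
    -- height of the set of words that are not `n`-divisible
    (∀ n l : ℕ, 2 ≤ n → ∃ h : ℕ,
      Shirshov.IsSetHeight {W : FreeMonoid (Fin l) | ¬ Shirshov.NDivisible n W}
        (Shirshov.shortWords (Fin l) n) h ∧ (h : ℝ) ≤ Shirshov.Phi n l) ∧
    -- for fixed `l`, `Φ(n, l) = n ^ (12 (1 + o(1)) log₃ n)` as `n → ∞`
    (∀ l : ℕ, 1 ≤ l → ∃ ε : ℕ → ℝ, Filter.Tendsto ε Filter.atTop (nhds 0) ∧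
      ∀ n : ℕ, 2 ≤ n → Shirshov.Phi n l = (n : ℝ) ^ (12 * (1 + ε n) * Real.logb 3 n)) ∧
    -- in particular `Φ` is subexponential in `n`
    (∀ (l : ℕ) (c : ℝ), 1 < c →
      Asymptotics.IsLittleO Filter.atTop (fun n : ℕ => Shirshov.Phi n l) (fun n : ℕ => c ^ n)) ∧
    -- for fixed `n`, `Φ` is linearly bounded in `l`
    (∀ n : ℕ, 2 ≤ n → ∃ C : ℝ, ∀ l : ℕ, 1 ≤ l → Shirshov.Phi n l < C * l) ∧
    -- height of `l`-generated PI-algebras, not assumed unital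
    (∀ (K : Type*) (A : Type*) [CommRing K] [NonUnitalRing A] [Module K A]
      [IsScalarTower K A A] [SMulCommClass K A A] (n l : ℕ) (a : Fin l → A)
      (f : Shirshov.NCPoly K), 2 ≤ n → NonUnitalAlgebra.adjoin K (Set.range a) = ⊤ →
      f.Admissible → f.degree = n → Shirshov.IsIdentity A f →
      ∃ h : ℕ, Shirshov.IsAlgHeight K a n h ∧ (h : ℝ) ≤ Shirshov.Phi n l) ∧
    -- height of `l`-generated unital PI-algebras
    (∀ (K : Type*) (A : Type*) [CommRing K] [Ring A] [Algebra K A] (n l : ℕ) (a : Fin l → A)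
      (f : Shirshov.NCPoly K), 2 ≤ n → Algebra.adjoin K (Set.range a) = ⊤ →
      f.Admissible → f.degree = n → Shirshov.IsUnitalIdentity A f →
      ∃ h : ℕ, Shirshov.IsUnitalAlgHeight K a n h ∧ (h : ℝ) ≤ Shirshov.Phi n l) ∧
    -- the nilpotency class of the free `l`-generated ring with `x ^ m = 0` is subexponential in `m`
    (∀ l : ℕ, ∃ N : ℕ → ℕ,
      (∀ m : ℕ, 1 ≤ m → Shirshov.IsNilpotencyClass (Shirshov.FreeNilRing l m) (N m)) ∧
      ∀ c : ℝ, 1 < c → Asymptotics.IsLittleO Filter.atTop (fun m : ℕ => (N m : ℝ))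
        (fun m : ℕ => c ^ m)) := by
  refine ⟨fun n l hn => ?_, fun l hl => Shirshov.exists_Phi_eq_rpow hl, fun l c hc => ?_,
    fun n hn => ?_, ?_, ?_, Shirshov.exists_nilpotencyClass_isLittleO⟩
  · obtain ⟨k, hk, hkP⟩ := Shirshov.exists_height_bound hn l
    obtain ⟨h, h1, h2⟩ := Shirshov.exists_isLeast_le (P := fun k =>
      {W : FreeMonoid (Fin l) | ¬ Shirshov.NDivisible n W} ⊆
        Shirshov.powProducts (Shirshov.shortWords (Fin l) n) k) hk
    exact ⟨h, h1, le_trans (by exact_mod_cast h2) hkP⟩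
  · simpa using Shirshov.pow_mul_Phi_isLittleO 0 l hc
  -- The summand `1` makes the inequality strict.
  · refine ⟨Shirshov.Phi n 1 + 1, fun l hl => ?_⟩
    have hl0 : (0 : ℝ) < l := by exact_mod_cast hl
    rw [Shirshov.Phi_eq_mul]
    nlinarith
  · intro K A _ _ _ _ _ n l a f hn ha hadm hdeg hf
    exact Shirshov.exists_isSpanHeight Shirshov.mul_mem_range_inr
      (Shirshov.eval_eq_zero_of_isIdentity hf) (fun i => Shirshov.inr_mem_range (a i)) 1
      (Shirshov.range_inr_eq_span_words ha) hadm hn hdeg.le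
  · intro K A _ _ _ n l a f hn ha hadm hdeg hf
    exact Shirshov.exists_isSpanHeight (S := ⊤) (fun _ _ _ _ => Submodule.mem_top)
      (fun x _ => hf x) (fun _ => Submodule.mem_top) 0
      (Shirshov.top_eq_span_words ha) hadm hn hdeg.le
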